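/- **Setting.** Let $\mathbb T\subseteq\mathbb R$ be a nonempty open interval, $\Omega\subseteq\mathbb R^{(l+1)n}$ a nonempty connected open set with coordinates $(x,\dot x,\dots,x^{(l)})$, and $F=(F_1,\dots,F_n):\mathbb T\times\Omega\to\mathbb R^n$ real analytic; consider the DAE $F(t,x,\dot x,\dots,x^{(l)})=0$. For a function $f$ let $\mathrm{ord}(f,x_j)$ be the largest $k$ with $\partial f/\partial x_j^{(k)}\not\equiv0$ ($-\infty$ if there is none), and let $f^{(d)}$ be the $d$-th formal total derivative in $t$, a function on $\mathbb T\times\Omega^{(d)}$ with $\Omega^{(d)}=\Omega\times\mathbb R^{dn}$. Let $c_{ij}=\mathrm{ord}(F_i,x_j)$ and let $(p,q)\in\mathbb Z^n\times\mathbb Z^n$ be an optimal solution of the dual assignment problem: minimize $\sum_j q_j-\sum_i p_i$ subject to $q_j-p_i\ge c_{ij}$ whenever $c_{ij}>-\infty$. The system Jacobian is $D=(\partial F_i/\partial x_j^{(q_j-p_i)})_{i,j}$ (an entry is $0$ if $q_j-p_i<0$ or $q_j-p_i>l$), a matrix over the quotient field $\mathbb F$ of the ring of real analytic functions on $\mathbb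 T\times\Omega$. Assume: - (I1) the bipartite graph with edges $\{(i,j):c_{ij}>-\infty\}$ has a perfect matching; - (I2) every square submatrix of $D$ that is not identically singular is nonsingular at some consistent point, i.e. at a point of $\mathbb T\times\Omega$ through which a smooth local solution of the DAE passes; - (I3) $D$ is identically singular. Let $r\in\{1,\dots,n\}$, $I\subseteq\{1,\dots,n\}\setminus\{r\}$ and $J\subseteq\{1,\dots,n\}$ with $|I|=|J|$ satisfy (C1) $D[I,J]$ is nonsingular over $\mathbb F$; (C2) $\mathrm{rank}\,D[I\cup\{r\},\{1,\dots,n\}]=|I|$; (C3) $p_r\le p_i$ for all $i\in I$. Put $\kappa=\max_{i\in I}p_i-p_r$. *Substitution method.* On a product $\mathbb T'\times V\times W\subseteq\mathbb T\times\Omega^{(\kappa)}$ of nonempty open sets, where $W$ is a connected set in the space of the coordinates $x_J^{(q-p_r\mathbf 1)}=(x_j^{(q_j-p_r)})_{j\in J}$ and $V$ is a set in the space of the remaining ones, let $\varphi:\mathbb T'\times V\to W$ be an explicit function of $F_I^{(p-p_r\mathbf 1)}:=(F_i^{(p_i-p_r)})_{i\in I}=0$ as in the implicit function theorem: $\varphi$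 is real analytic, the zeros of $F_I^{(p-p_r\mathbf 1)}$ in $\mathbb T'\times V\times W$ are exactly the points with $x_J^{(q-p_r\mathbf 1)}=\varphi$, and $\partial F_I^{(p-p_r\mathbf 1)}/\partial x_J^{(q-p_r\mathbf 1)}$ is nonsingular at these points. The output $F^{\mathrm{sub}}$, defined on $\mathbb T'\times V\times W$, arises from $F$ by substituting $x_J^{(q-p_r\mathbf 1)}=\varphi$ in $F_r$; the other equations are kept. *LC-method.* For a nonzero row vector $u\in\mathbb F^n$ with $uD=0$ and an $r\in\mathrm{supp}\,u$ with $p_r\le p_i$ for all $i\in\mathrm{supp}\,u$, the output $F^{\mathrm{LC}}$ arises from $F$ by replacing $F_r$ by $u_rF_r+\sum_{i\in\mathrm{supp}\,u\setminus\{r\}}u_iF_i^{(p_i-p_r)}$. The validity condition is $$\mathrm{ord}(u_i,x_j)<q_j-p_r\qquad\text{for all } i,j.\tag{$*$}$$ **Theorem.** Define $u\in\mathbb F^n$ by $u_r=1$, $u_I=-D[\{r\},J]\,D[I,J]^{-1}$, and $u_i=0$ for $i\notin I\cup\{r\}$. Then: 1. $uD=0$, and $r$ is an admissible choice of the LC-method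 for $u$. 2. The substitution method has an output for $(r,I,J)$. If $u$ satisfies $(*)$, then every output $F^{\mathrm{sub}}$ of the substitution method for $(r,I,J)$ equals the output $F^{\mathrm{LC}}$ of the LC-method for $u$ and $r$, on the domain $\mathbb T'\times V\times W$ of $F^{\mathrm{sub}}$ (as meromorphic functions, that is, if $F^{\mathrm{LC}}_i=a/b$ with analytic $a$ and $b\not\equiv0$ on $\mathbb T\times\Omega^{(\kappa)}$, then $a=b\,F^{\mathrm{sub}}_i$ there). 3. If $u$ violates $(*)$, then so does every $v\in\mathbb F^n$ with $vD=0$ and $\mathrm{supp}\,v=I\cup\{r\}$ ($r$ being an admissible choice for $v$ too). -/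

import Mathlib

noncomputable section

open scoped Matrix

namespace StructuralDAE

/-! ### Jets, partial derivatives and total derivatives -/

/-- Points `(t, x, ẋ, …, x^(L))` of `ℝ × ℝ^{(L+1)n}`; the coordinate `x_j^(k)` has index `(j, k)`. -/
abbrev Jet (n L : ℕ) := ℝ × (Fin n × Fin (L + 1) → ℝ)

/-- For `L ≤ M` this is the projection `(t, x, …, x^(M)) ↦ (t, x, …, x^(L))`, the only way in which it
enters the definitions below.  (For `L > M` the missing coordinates are set to `0`; this is used
only to prove that the projections are surjective.) -/
def resize {n M : ℕ} (L : ℕ) (z : Jet n M) : Jet n L :=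
  (z.1, fun c => if h : (c.2 : ℕ) < M + 1 then z.2 (c.1, ⟨c.2, h⟩) else 0)

/-- The unit vector in the direction of the coordinate `x_j^(k)`. -/
def unitX {n L : ℕ} (j : Fin n) (k : Fin (L + 1)) : Jet n L := (0, Pi.single (j, k) 1)

/-- `∂f/∂x_j^(k)`, which is identically zero if `k` is not the order of a variable of `f`. -/
def pderiv {n L : ℕ} (f : Jet n L → ℝ) (j : Fin n) (k : ℤ) (z : Jet n L) : ℝ :=
  if h : 0 ≤ k ∧ k.toNat < L + 1 then fderiv ℝ f z (unitX j ⟨k.toNat, h.2⟩) else 0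

/-- The derivative `ḟ = ∂f/∂t + ∑_{j,k} (∂f/∂x_j^(k)) x_j^(k+1)` of `f` with respect to `t`. -/
def totalDeriv {n L : ℕ} (f : Jet n L → ℝ) (z : Jet n (L + 1)) : ℝ :=
  fderiv ℝ f (resize L z) (1, 0) +
    ∑ j : Fin n, ∑ k : Fin (L + 1), fderiv ℝ f (resize L z) (unitX j k) * z.2 (j, k.succ)

/-- The `d`-th order derivative `f^(d)`. -/
def iterDeriv {n L : ℕ} (f : Jet n L → ℝ) : (d : ℕ) → Jet n (L + d) → ℝ
  | 0 => f
  | d + 1 => totalDeriv (iterDeriv f d)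

/-- The largest order `k` satisfying `P`, and `-∞ = ⊥` if there is none. -/
def maxOrder {L : ℕ} (P : Fin (L + 1) → Prop) : WithBot ℤ :=
  open Classical in (Finset.univ.filter P).sup fun k => (((k : ℕ) : ℤ) : WithBot ℤ)

/-- `ord(f, x_j)` for a function `f` with domain `U`. -/
def ord {n L : ℕ} (U : Set (Jet n L)) (f : Jet n L → ℝ) (j : Fin n) : WithBot ℤ :=
  maxOrder fun k : Fin (L + 1) => ∃ z ∈ U, fderiv ℝ f z (unitX j k) ≠ 0

/-! ### The ring of real analytic functions on an open set -/

/-- The ring of real analytic functions on `U`. -/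
def analyticRing {E : Type*} [NormedAddCommGroup E] [NormedSpace ℝ E] (U : Set E) :
    Subring (U → ℝ) where
  carrier := {f | ∃ g : E → ℝ, AnalyticOnNhd ℝ g U ∧ ∀ x : U, f x = g x}
  mul_mem' := by
    rintro a b ⟨g, hg, hga⟩ ⟨h, hh, hhb⟩
    exact ⟨g * h, hg.mul hh, fun x => by simp [hga, hhb]⟩
  one_mem' := ⟨fun _ => 1, analyticOnNhd_const, fun _ => rfl⟩
  add_mem' := by
    rintro a b ⟨g, hg, hga⟩ ⟨h, hh, hhb⟩
    exact ⟨g + h, hg.add hh, fun x => by simp [hga, hhb]⟩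
  zero_mem' := ⟨fun _ => 0, analyticOnNhd_const, fun _ => rfl⟩
  neg_mem' := by
    rintro a ⟨g, hg, hga⟩
    exact ⟨-g, hg.neg, fun x => by simp [hga]⟩

/-- The restriction to `U` of a function that is analytic on `U`. -/
def restrict {E : Type*} [NormedAddCommGroup E] [NormedSpace ℝ E] {U : Set E} (g : E → ℝ)
    (hg : AnalyticOnNhd ℝ g U) : analyticRing U :=
  ⟨fun x => g x, g, hg, fun _ => rfl⟩

theorem isDomain_analyticRing {E : Type*} [NormedAddCommGroup E] [NormedSpace ℝ E] {U : Set E}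
    (hU : IsOpen U) (hc : IsPreconnected U) (hne : U.Nonempty) : IsDomain (analyticRing U) := by
  have : Nontrivial (analyticRing U) := by
    obtain ⟨x, hx⟩ := hne
    refine ⟨0, 1, fun h => ?_⟩
    have := congrFun (congrArg Subtype.val h) ⟨x, hx⟩
    simp at this
  have : NoZeroDivisors (analyticRing U) := by
    refine ⟨?_⟩
    rintro ⟨a, g, hg, hga⟩ ⟨b, h, hh, hhb⟩ hab
    have hab' : ∀ x ∈ U, g x * h x = 0 := by
      intro x hx
      have := congrFun (congrArg Subtype.val hab) ⟨x, hx⟩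
      simpa [hga, hhb] using this
    by_cases hz : ∀ x ∈ U, g x = 0
    · left
      apply Subtype.ext
      funext x
      simpa [hga] using hz x x.2
    · right
      push Not at hz
      obtain ⟨x₀, hx₀, hgx⟩ := hz
      have hev : h =ᶠ[nhds x₀] 0 := by
        filter_upwards [(hg x₀ hx₀).continuousAt.eventually_ne hgx, hU.mem_nhds hx₀] with y hy hyU
        exact (mul_eq_zero.mp (hab' y hyU)).resolve_left hy
      have := hh.eqOn_zero_of_preconnected_of_eventuallyEq_zero hc hx₀ hev
      apply Subtype.ext
      funext x
      simpa [hhb] using this x.2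
  exact NoZeroDivisors.to_isDomain _

/-- The derivative of `a` in the direction `v`, as a function on the open set `U`. -/
def ringDeriv {E : Type*} [NormedAddCommGroup E] [NormedSpace ℝ E] {U : Set E}
    (v : E) (a : analyticRing U) (x : U) : ℝ :=
  fderiv ℝ (Function.extend Subtype.val a.1 0) x v

/-- `ord(f, x_j)` for an element `f = a / b` of the quotient field of the ring of analytic
functions on `U`: the partial derivative of `f` is `(∂a · b - a · ∂b) / b²`. -/
def fracOrd {n L : ℕ} {U : Set (Jet n L)} (f : FractionRing (analyticRing U)) (j : Fin n) :
    WithBot ℤ :=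
  maxOrder fun k : Fin (L + 1) => ∃ a b : analyticRing U, b ≠ 0 ∧
    f * algebraMap _ (FractionRing (analyticRing U)) b = algebraMap _ _ a ∧
      ∃ z : U, ringDeriv (unitX j k) a z * b.1 z ≠ a.1 z * ringDeriv (unitX j k) b z

/-- The element `f` of the quotient field of the ring of analytic functions on `U` coincides with
the function `h` on the open set `V ⊆ U`: whenever `f = a / b`, then `a = h b` on `V`. -/
def FracEqOn {E : Type*} [NormedAddCommGroup E] [NormedSpace ℝ E] {U : Set E}
    (f : FractionRing (analyticRing U)) (h : E → ℝ) (V : Set E) : Prop :=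
  ∀ a b : analyticRing U, b ≠ 0 →
    f * algebraMap _ (FractionRing (analyticRing U)) b = algebraMap _ _ a →
      ∀ z : U, (z : E) ∈ V → a.1 z = h z * b.1 z

/-! ### Facts on jets that the definitions need -/

section Jets

variable {n L M N : ℕ}

theorem analyticAt_resize (L : ℕ) (z : Jet n M) :
    AnalyticAt ℝ (resize L : Jet n M → Jet n L) z := by
  refine analyticAt_fst.prod ?_
  rw [analyticAt_pi_iff]
  intro c
  by_cases h : (c.2 : ℕ) < M + 1
  · simp only [h, dif_pos]
    exact ((ContinuousLinearMap.proj (R := ℝ) (φ := fun _ : Fin n × Fin (M + 1) => ℝ)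
      (c.1, ⟨c.2, h⟩)).comp (ContinuousLinearMap.snd ℝ ℝ _)).analyticAt z
  · simp only [h, dif_neg, not_false_eq_true]
    exact analyticAt_const

theorem continuous_resize (L : ℕ) : Continuous (resize L : Jet n M → Jet n L) :=
  continuous_iff_continuousAt.mpr fun z => (analyticAt_resize L z).continuousAt

theorem resize_resize (h : L ≤ M) (z : Jet n N) :
    resize L (resize M z) = resize L z := by
  refine Prod.ext rfl ?_
  funext c
  have : (c.2 : ℕ) < M + 1 := lt_of_lt_of_le c.2.2 (by omega)
  simp only [resize, dif_pos this]

theorem resize_self (z : Jet n L) : resize L z = z := by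
  refine Prod.ext rfl ?_
  funext c
  simp only [resize, dif_pos c.2.2]

theorem isPreconnected_preimage_resize (h : L ≤ M) {U : Set (Jet n L)} (hU : IsPreconnected U) :
    IsPreconnected (resize L ⁻¹' U : Set (Jet n M)) := by
  let merge : Jet n L × Jet n M → Jet n M := fun y => resize M y.1 + (y.2 - resize M (resize L y.2))
  have hm : Continuous merge :=
    ((continuous_resize M).comp continuous_fst).add (continuous_snd.sub
      ((continuous_resize M).comp ((continuous_resize L).comp continuous_snd)))
  have himg : merge '' (U ×ˢ Set.univ) = (resize L ⁻¹' U : Set (Jet n M)) := by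
    ext w
    constructor
    · rintro ⟨⟨u, y⟩, ⟨hu, -⟩, rfl⟩
      have : resize L (merge (u, y)) = u := by
        refine Prod.ext ?_ ?_
        · simp [merge, resize]
        · funext c
          have h1 : (c.2 : ℕ) < M + 1 := lt_of_lt_of_le c.2.2 (by omega)
          have h2 : (c.2 : ℕ) < L + 1 := c.2.2
          simp only [merge, resize, Prod.snd_add, Prod.snd_sub, Pi.add_apply, Pi.sub_apply,
            dif_pos h1, dif_pos h2, sub_self, add_zero]
      change resize L (merge (u, y)) ∈ U
      rw [this]
      exact hu
    · intro hw
      exact ⟨(resize L w, w), ⟨hw, trivial⟩, by simp [merge]⟩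
  rw [← himg]
  exact (hU.prod isPreconnected_univ).image _ hm.continuousOn

theorem analyticOnNhd_fderiv_apply {E : Type*} [NormedAddCommGroup E] [NormedSpace ℝ E]
    {U : Set E} {f : E → ℝ} (hf : AnalyticOnNhd ℝ f U) (v : E) :
    AnalyticOnNhd ℝ (fun z => fderiv ℝ f z v) U := fun z hz =>
  ((ContinuousLinearMap.apply ℝ ℝ v).analyticAt _).comp (hf.fderiv z hz)

theorem analyticOnNhd_pderiv {U : Set (Jet n L)} {f : Jet n L → ℝ} (hf : AnalyticOnNhd ℝ f U)
    (j : Fin n) (k : ℤ) : AnalyticOnNhd ℝ (pderiv f j k) U := by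
  by_cases h : 0 ≤ k ∧ k.toNat < L + 1
  · have : pderiv f j k = fun z => fderiv ℝ f z (unitX j ⟨k.toNat, h.2⟩) := by
      funext z
      simp only [pderiv, dif_pos h]
    rw [this]
    exact analyticOnNhd_fderiv_apply hf _
  · have : pderiv f j k = fun _ => 0 := by
      funext z
      simp only [pderiv, dif_neg h]
    rw [this]
    exact analyticOnNhd_const

theorem analyticOnNhd_comp_resize {U : Set (Jet n L)} {f : Jet n L → ℝ}
    (hf : AnalyticOnNhd ℝ f U) :
    AnalyticOnNhd ℝ (fun z : Jet n M => f (resize L z)) (resize L ⁻¹' U) := fun z hz =>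
  (hf (resize L z) hz).comp (analyticAt_resize L z)

theorem analyticOnNhd_totalDeriv {U : Set (Jet n L)} {f : Jet n L → ℝ}
    (hf : AnalyticOnNhd ℝ f U) : AnalyticOnNhd ℝ (totalDeriv f) (resize L ⁻¹' U) := by
  refine (analyticOnNhd_comp_resize (analyticOnNhd_fderiv_apply hf (1, 0))).add ?_
  refine Finset.univ.analyticOnNhd_fun_sum fun j _ => ?_
  refine Finset.univ.analyticOnNhd_fun_sum fun k _ => ?_
  refine (analyticOnNhd_comp_resize (analyticOnNhd_fderiv_apply hf (unitX j k))).mul ?_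
  exact fun z _ => ((ContinuousLinearMap.proj (R := ℝ) (φ := fun _ : Fin n × Fin (L + 1 + 1) => ℝ)
      (j, k.succ)).comp (ContinuousLinearMap.snd ℝ ℝ _)).analyticAt z

theorem analyticOnNhd_iterDeriv {U : Set (Jet n L)} {f : Jet n L → ℝ}
    (hf : AnalyticOnNhd ℝ f U) (d : ℕ) :
    AnalyticOnNhd ℝ (iterDeriv f d) (resize L ⁻¹' U) := by
  induction d with
  | zero =>
    intro z hz
    have h : resize L z ∈ U := hz
    exact hf z (by rwa [show resize L z = z from resize_self (L := L) z] at h)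
  | succ d ih =>
    refine (analyticOnNhd_totalDeriv ih).mono ?_
    intro z hz
    change resize L (resize (L + d) z) ∈ U
    rw [resize_resize (by omega)]
    exact hz

end Jets

/-! ### Differential-algebraic equations -/

/-- An `l`-th order DAE `F(t, x, ẋ, …, x^(l)) = 0` of size `n`: a real analytic
`F : 𝕋 × Ω → ℝⁿ` with `𝕋` a nonempty open interval and `Ω` a nonempty connected open set.
(The values of `F` outside `𝕋 × Ω` are never used.) -/
structure DAE (n l : ℕ) where
  T : Set ℝ
  Om : Set (Fin n × Fin (l + 1) → ℝ)
  F : Fin n → Jet n l → ℝ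
  isOpen_T : IsOpen T
  ordConnected_T : T.OrdConnected
  nonempty_T : T.Nonempty
  isOpen_Om : IsOpen Om
  isPreconnected_Om : IsPreconnected Om
  nonempty_Om : Om.Nonempty
  analytic_F : ∀ i, AnalyticOnNhd ℝ (F i) (T ×ˢ Om)

namespace DAE

variable {n l : ℕ} (S : DAE n l)

/-- The domain `𝕋 × Ω`. -/
def dom : Set (Jet n l) := S.T ×ˢ S.Om

/-- The domain `𝕋 × Ω^(d) = 𝕋 × Ω × ℝ^{dn}`. -/
def domExt (d : ℕ) : Set (Jet n (l + d)) := resize l ⁻¹' S.dom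

theorem isOpen_dom : IsOpen S.dom := S.isOpen_T.prod S.isOpen_Om

theorem isPreconnected_dom : IsPreconnected S.dom :=
  S.ordConnected_T.isPreconnected.prod S.isPreconnected_Om

theorem nonempty_dom : S.dom.Nonempty := S.nonempty_T.prod S.nonempty_Om

instance : IsDomain (analyticRing S.dom) :=
  isDomain_analyticRing S.isOpen_dom S.isPreconnected_dom S.nonempty_dom

theorem exists_resize_eq (d : ℕ) (z : S.dom) :
    ∃ w : S.domExt d, resize l (w : Jet n (l + d)) = z := by
  have h : resize l (resize (l + d) (z : Jet n l)) = z := by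
    rw [resize_resize (by omega), resize_self]
  refine ⟨⟨resize (l + d) (z : Jet n l), ?_⟩, h⟩
  change resize l (resize (l + d) (z : Jet n l)) ∈ S.dom
  rw [h]
  exact z.2

instance (d : ℕ) : IsDomain (analyticRing (S.domExt d)) := by
  refine isDomain_analyticRing (S.isOpen_dom.preimage (continuous_resize l))
    (isPreconnected_preimage_resize (by omega) S.isPreconnected_dom) ?_
  obtain ⟨z, hz⟩ := S.nonempty_dom
  obtain ⟨w, -⟩ := S.exists_resize_eq d ⟨z, hz⟩
  exact ⟨w, w.2⟩

/-- The quotient field of the ring of real analytic functions on `𝕋 × Ω`. -/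
abbrev K := FractionRing (analyticRing S.dom)

/-- The quotient field of the ring of real analytic functions on `𝕋 × Ω^(d)`. -/
abbrev KExt (d : ℕ) := FractionRing (analyticRing (S.domExt d))

/-- An analytic function on `𝕋 × Ω` regarded as an analytic function on `𝕋 × Ω^(d)`. -/
def liftRing (d : ℕ) : analyticRing S.dom →+* analyticRing (S.domExt d) where
  toFun a := ⟨fun w => a.1 ⟨resize l (w : Jet n (l + d)), w.2⟩, by
    obtain ⟨a, g, hg, hga⟩ := a
    exact ⟨fun w => g (resize l w), analyticOnNhd_comp_resize hg, fun w => hga _⟩⟩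
  map_one' := rfl
  map_mul' _ _ := rfl
  map_zero' := rfl
  map_add' _ _ := rfl

theorem liftRing_injective (d : ℕ) : Function.Injective (S.liftRing d) := by
  intro a b hab
  apply Subtype.ext
  funext z
  obtain ⟨w, hw⟩ := S.exists_resize_eq d z
  have h : a.1 ⟨resize l (w : Jet n (l + d)), w.2⟩ = b.1 ⟨resize l (w : Jet n (l + d)), w.2⟩ :=
    congrFun (congrArg Subtype.val hab) w
  have hz : (⟨resize l (w : Jet n (l + d)), w.2⟩ : S.dom) = z := Subtype.ext hw
  rwa [hz] at h

/-- The inclusion of the quotient field for `𝕋 × Ω` into the one for `𝕋 × Ω^(d)`. -/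
def lift (d : ℕ) : S.K →+* S.KExt d := IsFractionRing.map (S.liftRing_injective d)

/-- The derivative `F_i^(d)`, regarded as a function of `(t, x, …, x^(l+e))` where `d ≤ e`. -/
def dF (i : Fin n) (d e : ℕ) (z : Jet n (l + e)) : ℝ := iterDeriv (S.F i) d (resize (l + d) z)

theorem analyticOnNhd_dF (i : Fin n) (d e : ℕ) :
    AnalyticOnNhd ℝ (S.dF i d e) (S.domExt e) := by
  refine (analyticOnNhd_comp_resize (analyticOnNhd_iterDeriv (S.analytic_F i) d)).mono ?_
  intro z hz
  change resize l (resize (l + d) z) ∈ S.dom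
  rw [resize_resize (by omega)]
  exact hz

/-- The point `(t, x(t), ẋ(t), …, x^(l)(t))` on a trajectory `x`. -/
def jetOf (l : ℕ) {n : ℕ} (x : ℝ → Fin n → ℝ) (t : ℝ) : Jet n l :=
  (t, fun c => iteratedDeriv c.2 (fun s => x s c.1) t)

/-- A consistent point: a point of `𝕋 × Ω` through which a smooth local solution passes. -/
def IsConsistentPoint (z : Jet n l) : Prop :=
  ∃ (I : Set ℝ) (x : ℝ → Fin n → ℝ), IsOpen I ∧ I.OrdConnected ∧ I ⊆ S.T ∧ z.1 ∈ I ∧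
    ContDiffOn ℝ ((⊤ : ℕ∞) : WithTop ℕ∞) x I ∧
    (∀ t ∈ I, jetOf l x t ∈ S.dom ∧ ∀ i, S.F i (jetOf l x t) = 0) ∧ jetOf l x z.1 = z

/-! ### The assignment problem and the system Jacobian -/

/-- `c_{i,j} = ord(F_i, x_j)`; the pair `(i, j)` is an edge of the graph `G(F)` iff `c_{i,j} ≠ -∞`. -/
def c (i j : Fin n) : WithBot ℤ := ord S.dom (S.F i) j

/-- `G(F)` has a perfect matching. -/
def HasPerfectMatching : Prop := ∃ σ : Equiv.Perm (Fin n), ∀ i, S.c i (σ i) ≠ ⊥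

/-- Feasibility in the dual assignment problem. -/
def DualFeasible (p q : Fin n → ℤ) : Prop :=
  ∀ i j, S.c i j ≠ ⊥ → S.c i j ≤ ((q j - p i : ℤ) : WithBot ℤ)

/-- Optimality in the dual assignment problem: minimize `∑ q_j - ∑ p_i`. -/
def DualOptimal (p q : Fin n → ℤ) : Prop :=
  S.DualFeasible p q ∧ ∀ p' q' : Fin n → ℤ, S.DualFeasible p' q' →
    ∑ j, q j - ∑ i, p i ≤ ∑ j, q' j - ∑ i, p' i

/-- The value at a point of the system Jacobian `D_{i,j} = ∂F_i/∂x_j^(q_j - p_i)`. -/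
def jacAt (p q : Fin n → ℤ) (z : Jet n l) : Matrix (Fin n) (Fin n) ℝ :=
  Matrix.of fun i j => pderiv (S.F i) j (q j - p i) z

/-- The system Jacobian as a matrix over the quotient field. -/
def jac (p q : Fin n → ℤ) : Matrix (Fin n) (Fin n) S.K :=
  Matrix.of fun i j => algebraMap (analyticRing S.dom) S.K
    (restrict (pderiv (S.F i) j (q j - p i)) (analyticOnNhd_pderiv (S.analytic_F i) j _))

/-- The square submatrix `A[I, J]`, with rows and columns in increasing order. -/
def sub {α : Type*} (A : Matrix (Fin n) (Fin n) α) (I J : Finset (Fin n)) (h : I.card = J.card) :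
    Matrix (Fin I.card) (Fin I.card) α :=
  A.submatrix (I.orderEmbOfFin rfl) (J.orderEmbOfFin h.symm)

/-- The input conditions (I1)-(I3) for the substitution method, with respect to `(p, q)`. -/
structure InputConditions (p q : Fin n → ℤ) : Prop where
  perfectMatching : S.HasPerfectMatching
  exists_consistent : ∀ (I J : Finset (Fin n)) (h : I.card = J.card),
    (∃ z ∈ S.dom, (sub (S.jacAt p q z) I J h).det ≠ 0) →
      ∃ z ∈ S.dom, S.IsConsistentPoint z ∧ (sub (S.jacAt p q z) I J h).det ≠ 0
  singular : ∀ z ∈ S.dom, (S.jacAt p q z).det = 0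

/-- The conditions (C1)-(C3) on a triple `(r, I, J)`. -/
structure IsTriple (p q : Fin n → ℤ) (r : Fin n) (I J : Finset (Fin n)) : Prop where
  notMem : r ∉ I
  card_eq : I.card = J.card
  nonsingular : (sub (S.jac p q) I J card_eq).det ≠ 0
  rank_eq : ((S.jac p q).submatrix (fun i : ↥(insert r I) => (i : Fin n)) id).rank = I.card
  le : ∀ i ∈ I, p r ≤ p i

/-! ### The LC-method -/

/-- `u` is in the cokernel of `D`. -/
def IsCokernel (p q : Fin n → ℤ) (u : Fin n → S.K) : Prop := u ᵥ* S.jac p q = 0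

/-- The support of `u`. -/
def supp (u : Fin n → S.K) : Finset (Fin n) := open Classical in Finset.univ.filter fun i => u i ≠ 0

/-- The LC-method may choose the row `r` for the vector `u`. -/
def IsPivot (p : Fin n → ℤ) (u : Fin n → S.K) (r : Fin n) : Prop :=
  r ∈ S.supp u ∧ ∀ i ∈ S.supp u, p r ≤ p i

/-- The validity condition `ord(u_i, x_j) < q_j - p_r` of the LC-method. -/
def LCValid (p q : Fin n → ℤ) (r : Fin n) (u : Fin n → S.K) : Prop :=
  ∀ i j, fracOrd (u i) j < ((q j - p r : ℤ) : WithBot ℤ)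

/-- The DAE returned by the LC-method for `u` and `r`, over `𝕋 × Ω^(e)` with
`e ≥ p_i - p_r` for `i ∈ supp u`: the function `F_r` is replaced by
`u_r F_r + ∑_{i ∈ supp u \ {r}} u_i F_i^(p_i - p_r)`. -/
def lcOutput (p : Fin n → ℤ) (r : Fin n) (u : Fin n → S.K) (e : ℕ) (i : Fin n) : S.KExt e :=
  if i = r then
    S.lift e (u r) * algebraMap (analyticRing (S.domExt e)) (S.KExt e)
        (restrict (S.dF r 0 e) (S.analyticOnNhd_dF r 0 e)) +
      ∑ k ∈ (S.supp u).erase r, S.lift e (u k) * algebraMap (analyticRing (S.domExt e)) (S.KExt e)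
        (restrict (S.dF k (p k - p r).toNat e) (S.analyticOnNhd_dF k _ e))
  else algebraMap (analyticRing (S.domExt e)) (S.KExt e)
    (restrict (S.dF i 0 e) (S.analyticOnNhd_dF i 0 e))

/-! ### The substitution method -/

/-- `κ = max_{i ∈ I} p_i - p_r`. -/
def kappa (p : Fin n → ℤ) (r : Fin n) (I : Finset (Fin n)) : ℕ := I.sup fun i => (p i - p r).toNat

/-- The coordinates `x_J^(q - p_r 1)`, for which the equations are solved. -/
def IsSolved (p q : Fin n → ℤ) (r : Fin n) (J : Finset (Fin n)) {M : ℕ}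
    (c : Fin n × Fin (M + 1)) : Prop := c.1 ∈ J ∧ ((c.2 : ℕ) : ℤ) = q c.1 - p r

instance (p q : Fin n → ℤ) (r : Fin n) (J : Finset (Fin n)) {M : ℕ} :
    DecidablePred (IsSolved p q r J (M := M)) := fun _ => inferInstanceAs (Decidable (_ ∧ _))

/-- The point whose solved coordinates are `w` and whose other coordinates are `v`. -/
def glue {M : ℕ} {P : Fin n × Fin (M + 1) → Prop} [DecidablePred P] (v : {c // ¬ P c} → ℝ)
    (w : {c // P c} → ℝ) :
    Fin n × Fin (M + 1) → ℝ :=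
  fun c => if h : P c then w ⟨c, h⟩ else v ⟨c, h⟩

/-- An application of the implicit function theorem in the substitution method: around a point
of `𝕋 × Ω^(κ)` the equations `F_I^(p - p_r 1) = 0` are solved, on a product `T' × V × W` of open
sets, for `x_J^(q - p_r 1) = φ(t, the other coordinates)`.  As in the usual implicit function
theorem, `W` is taken to be connected (a ball, say). -/
structure ExplicitFunction (p q : Fin n → ℤ) (r : Fin n) (I J : Finset (Fin n))
    (h : I.card = J.card) where
  T' : Set ℝ
  V : Set ({c : Fin n × Fin (l + kappa p r I + 1) // ¬ IsSolved p q r J c} → ℝ)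
  W : Set ({c : Fin n × Fin (l + kappa p r I + 1) // IsSolved p q r J c} → ℝ)
  φ : ℝ × ({c : Fin n × Fin (l + kappa p r I + 1) // ¬ IsSolved p q r J c} → ℝ) →
    {c : Fin n × Fin (l + kappa p r I + 1) // IsSolved p q r J c} → ℝ
  isOpen_T' : IsOpen T'
  isOpen_V : IsOpen V
  isOpen_W : IsOpen W
  nonempty_T' : T'.Nonempty
  nonempty_V : V.Nonempty
  isConnected_W : IsConnected W
  subset_dom : ∀ t ∈ T', ∀ v ∈ V, ∀ w ∈ W, (t, glue v w) ∈ S.domExt (kappa p r I)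
  mapsTo : ∀ t ∈ T', ∀ v ∈ V, φ (t, v) ∈ W
  analytic : AnalyticOnNhd ℝ φ (T' ×ˢ V)
  eq_zero_iff : ∀ t ∈ T', ∀ v ∈ V, ∀ w ∈ W,
    (∀ i ∈ I, S.dF i (p i - p r).toNat (kappa p r I) (t, glue v w) = 0) ↔ w = φ (t, v)
  nonsingular : ∀ t ∈ T', ∀ v ∈ V,
    (sub (Matrix.of fun i j => pderiv (S.dF i (p i - p r).toNat (kappa p r I)) j (q j - p r)
      (t, glue v (φ (t, v)))) I J h).det ≠ 0

namespace ExplicitFunction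

variable {S} {p q : Fin n → ℤ} {r : Fin n} {I J : Finset (Fin n)} {h : I.card = J.card}
  (Φ : S.ExplicitFunction p q r I J h)

/-- The domain of the output of the substitution method, an open subset of `𝕋 × Ω^(κ)`. -/
def domain : Set (Jet n (l + kappa p r I)) :=
  {z | z.1 ∈ Φ.T' ∧ (fun c => z.2 c.1) ∈ Φ.V ∧ (fun c => z.2 c.1) ∈ Φ.W}

/-- The DAE returned by the substitution method: `x_J^(q - p_r 1) = φ` is substituted into `F_r`. -/
def output (i : Fin n) (z : Jet n (l + kappa p r I)) : ℝ :=
  if i = r then S.dF r 0 (kappa p r I) (z.1, glue (fun c => z.2 c.1) (Φ.φ (z.1, fun c => z.2 c.1)))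
  else S.dF i 0 (kappa p r I) z

end ExplicitFunction

/-- The vector `u` with `u_r = 1`, `u_I = -D[{r}, J] D[I, J]⁻¹`, and all other entries zero. -/
def specialVector (p q : Fin n → ℤ) (r : Fin n) (I J : Finset (Fin n)) (h : I.card = J.card)
    (i : Fin n) : S.K :=
  if i = r then 1
  else if hi : i ∈ I then
    (-((fun b => S.jac p q r (J.orderEmbOfFin h.symm b)) ᵥ* (sub (S.jac p q) I J h)⁻¹))
      ((I.orderIsoOfFin rfl).symm ⟨i, hi⟩)
  else 0

end DAE

end StructuralDAE

end

noncomputable section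

open scoped Matrix

/-! By Cramer's rule `u = α / δ` with `δ = det D[I, J]`. The equation of the LC-method is then `N /
δ` with `N = ∑ α_i F_i^(p_i - p_r)`, and the point is that `N / δ` does not depend on the solved
coordinates `x_J^(q - p_r 1)`. Dual feasibility says that `F_i` involves `x_j` only up to order `q_j
- p_i`. Each total derivative raises this bound by one and keeps the leading partial derivative, so
`∂F_i^(p_i - p_r)/∂x_j^(q_j - p_r) = D_ij` (`pderiv_dF`). Hence the derivative of `∑ u_i F_i^(p_i -
p_r)` along `x_j^(q_j - p_r)` is `∑ u_i D_ij + ∑ (∂u_i) F_i^(p_i - p_r)`: the first sum vanishes by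
`uD = 0`, the second by the validity condition (`fderiv_lcNumerator`). On the connected set `W` the
quotient is therefore constant. At the point given by `φ` the equations indexed by `I` vanish and
`u_r = 1`, so its value is `F_r` after substitution (`fracEqOn_output`). Zeros of `δ` in `W` are
handled by cross-multiplying and by the identity theorem.

The same formula identifies the Jacobian of `F_I^(p - p_r 1)` with `D[I, J]`. At a consistent point
where `D[I, J]` is nonsingular, all derivatives of the equations vanish on the jet of a solution, so
the implicit function theorem yields an output (`nonempty_explicitFunction`).

Nonsingularity of `D[I, J]` and the rank condition make row `r` a unique combination of the rows in
`I`. So `u` is in the cokernel, and every cokernel vector supported in `I ∪ {r}` is `v_r u`. If `v`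
were valid, so would be `u_i = v_i / v_r`, by the quotient rule (`lcValid_specialVector`). -/

namespace StructuralDAE

/-! ### Partial and total derivatives on jet spaces. -/

section JetCalculus

open scoped ContDiff Topology

variable {n L M : ℕ}

/-- The map `resize` as a continuous linear map. -/
def resizeL (n M L : ℕ) : Jet n M →L[ℝ] Jet n L where
  toFun := resize L
  map_add' x y := by
    refine Prod.ext rfl (funext fun c => ?_)
    simp only [resize, Prod.snd_add, Pi.add_apply]
    split_ifs <;> simp
  map_smul' a x := by
    refine Prod.ext rfl (funext fun c => ?_)
    simp only [resize, Prod.smul_snd, Pi.smul_apply, RingHom.id_apply]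
    split_ifs <;> simp
  cont := continuous_resize L

theorem fderiv_comp_resize {f : Jet n L → ℝ} {z : Jet n M}
    (hf : DifferentiableAt ℝ f (resize L z)) (v : Jet n M) :
    fderiv ℝ (fun y => f (resize L y)) z v = fderiv ℝ f (resize L z) (resize L v) := by
  have h : HasFDerivAt (fun y => f (resizeL n M L y))
      ((fderiv ℝ f (resizeL n M L z)).comp (resizeL n M L)) z :=
    HasFDerivAt.comp z (g := f) hf.hasFDerivAt (resizeL n M L).hasFDerivAt
  exact congrArg (fun T => T v) h.fderiv

/-- The unit vector in the direction of `x_j^(k)`, zero if there is no such coordinate. -/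
def unitZ (L : ℕ) (j : Fin n) (k : ℤ) : Jet n L :=
  (0, fun c => if c.1 = j ∧ ((c.2 : ℕ) : ℤ) = k then 1 else 0)

theorem unitZ_natCast (j : Fin n) (k : Fin (L + 1)) : unitZ L j ((k : ℕ) : ℤ) = unitX j k := by
  refine Prod.ext rfl (funext fun c => ?_)
  simp only [unitZ, unitX, Pi.single_apply, Prod.ext_iff, Fin.ext_iff, Nat.cast_inj]

theorem unitZ_eq_zero {j : Fin n} {k : ℤ} (h : ¬ (0 ≤ k ∧ k.toNat < L + 1)) :
    unitZ L j k = 0 := by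
  refine Prod.ext rfl (funext fun c => ?_)
  have : ((c.2 : ℕ) : ℤ) ≠ k := by
    have := c.2.2
    omega
  simp [unitZ, this]

/-- An order `k` out of range needs no separate treatment: the direction is then the zero vector. -/
theorem pderiv_eq_fderiv (f : Jet n L → ℝ) (j : Fin n) (k : ℤ) (z : Jet n L) :
    pderiv f j k z = fderiv ℝ f z (unitZ L j k) := by
  by_cases h : 0 ≤ k ∧ k.toNat < L + 1
  · have hk : ((k.toNat : ℕ) : ℤ) = k := Int.toNat_of_nonneg h.1
    have := unitZ_natCast j (⟨k.toNat, h.2⟩ : Fin (L + 1))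
    rw [pderiv, dif_pos h, ← this]
    simp only [hk]
  · rw [pderiv, dif_neg h, unitZ_eq_zero h, map_zero]

theorem resize_unitZ (h : L ≤ M) (j : Fin n) (k : ℤ) : resize L (unitZ M j k) = unitZ L j k := by
  refine Prod.ext rfl (funext fun c => ?_)
  have : (c.2 : ℕ) < M + 1 := by
    have := c.2.2
    omega
  simp only [resize, dif_pos this, unitZ]

/-- The linear map sending `x_j^(k)` to `x_j^(k+1)`. -/
def shiftL (n L : ℕ) : Jet n (L + 1) →L[ℝ] Jet n L :=
  (0 : Jet n (L + 1) →L[ℝ] ℝ).prod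
    (ContinuousLinearMap.pi fun c : Fin n × Fin (L + 1) =>
      (ContinuousLinearMap.proj (R := ℝ) (φ := fun _ : Fin n × Fin (L + 1 + 1) => ℝ)
        (c.1, c.2.succ)).comp (ContinuousLinearMap.snd ℝ ℝ _))

theorem shiftL_apply (z : Jet n (L + 1)) : shiftL n L z = (0, fun c => z.2 (c.1, c.2.succ)) := rfl

theorem shiftL_unitZ (j : Fin n) (k : ℤ) : shiftL n L (unitZ (L + 1) j k) = unitZ L j (k - 1) := by
  refine Prod.ext rfl (funext fun c => ?_)
  simp only [shiftL_apply, unitZ, Fin.val_succ]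
  congr 1
  simp only [Nat.cast_add, Nat.cast_one, eq_sub_iff_add_eq]

theorem jet_eq_sum (z : Jet n L) :
    z = z.1 • ((1, 0) : Jet n L) + ∑ j : Fin n, ∑ k : Fin (L + 1), z.2 (j, k) • unitX j k := by
  rw [← Fintype.sum_prod_type' (f := fun j k => z.2 (j, k) • unitX j k)]
  refine Prod.ext ?_ (funext fun c => ?_)
  · simp [unitX, Prod.fst_sum]
  · simp [unitX, Prod.snd_sum, Finset.sum_apply, Pi.single_apply]

/-- As a single directional derivative, the total derivative becomes accessible to the chain rule
and to the symmetry of second derivatives. -/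
theorem totalDeriv_eq_fderiv (f : Jet n L → ℝ) (z : Jet n (L + 1)) :
    totalDeriv f z = fderiv ℝ f (resize L z) ((1, 0) + shiftL n L z) := by
  conv_rhs => rw [map_add, jet_eq_sum (shiftL n L z)]
  simp [totalDeriv, shiftL_apply, map_sum, mul_comm]

theorem fderiv_fderiv_comm {E : Type*} [NormedAddCommGroup E] [NormedSpace ℝ E] {f : E → ℝ} {z : E}
    (hf : AnalyticAt ℝ f z) (v w : E) :
    fderiv ℝ (fun y => fderiv ℝ f y v) z w = fderiv ℝ (fderiv ℝ f) z v w := by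
  have hd : DifferentiableAt ℝ (fderiv ℝ f) z := hf.fderiv.differentiableAt
  have h := (hf.contDiffAt (n := 2)).isSymmSndFDerivAt (by simp)
  rw [h.eq, fderiv_clm_apply hd (differentiableAt_const v)]
  simp

/-- The direction `(1, shift z)` itself depends on `z`. Differentiating it along `x_j^(k)` gives the
unit vector of `x_j^(k-1)`, which is the second term; the first is the symmetry of second
derivatives. -/
theorem pderiv_totalDeriv {f : Jet n L → ℝ} {z : Jet n (L + 1)}
    (hf : AnalyticAt ℝ f (resize L z)) (j : Fin n) (k : ℤ) :
    pderiv (totalDeriv f) j k z = totalDeriv (pderiv f j k) z + pderiv f j (k - 1) (resize L z) := by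
  have hfun : totalDeriv f = fun y => fderiv ℝ f (resizeL n (L + 1) L y) ((1, 0) + shiftL n L y) :=
    funext (totalDeriv_eq_fderiv f)
  have hpd : pderiv f j k = fun y => fderiv ℝ f y (unitZ L j k) :=
    funext (pderiv_eq_fderiv f j k)
  have h1 : HasFDerivAt (fun y => fderiv ℝ f (resizeL n (L + 1) L y))
      ((fderiv ℝ (fderiv ℝ f) (resizeL n (L + 1) L z)).comp (resizeL n (L + 1) L)) z :=
    HasFDerivAt.comp z (g := fderiv ℝ f) hf.fderiv.differentiableAt.hasFDerivAt
      (resizeL n (L + 1) L).hasFDerivAt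
  have h2 : HasFDerivAt (fun y => ((1, 0) : Jet n L) + shiftL n L y) (shiftL n L) z :=
    (shiftL n L).hasFDerivAt.const_add _
  rw [pderiv_eq_fderiv, hfun, (h1.clm_apply h2).fderiv, totalDeriv_eq_fderiv, hpd,
    fderiv_fderiv_comm hf, pderiv_eq_fderiv, ← shiftL_unitZ, ← resize_unitZ (Nat.le_succ L) j k]
  simp only [add_apply, ContinuousLinearMap.comp_apply,
    ContinuousLinearMap.flip_apply]
  rw [add_comm]
  rfl

theorem totalDeriv_eq_zero {g : Jet n L → ℝ} {U : Set (Jet n L)} (hU : IsOpen U)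
    (hg : ∀ y ∈ U, g y = 0) {z : Jet n (L + 1)} (hz : resize L z ∈ U) : totalDeriv g z = 0 := by
  have : g =ᶠ[𝓝 (resize L z)] fun _ => 0 := by
    filter_upwards [hU.mem_nhds hz] with y hy using hg y hy
  rw [totalDeriv_eq_fderiv, this.fderiv_eq]
  simp

/-- If `f` does not depend on `x_j^(k)` for `k > m`, then `f^(d)` does not depend on `x_j^(k)` for
`k > m + d`, and `∂f^(d)/∂x_j^(m+d) = ∂f/∂x_j^(m)`. -/
theorem pderiv_iterDeriv {f : Jet n L → ℝ} {U : Set (Jet n L)} (hU : IsOpen U)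
    (hf : AnalyticOnNhd ℝ f U) {j : Fin n} {m : ℤ}
    (hm : ∀ k : ℤ, m < k → ∀ z ∈ U, pderiv f j k z = 0) (d : ℕ) :
    ∀ z : Jet n (L + d), resize L z ∈ U →
      pderiv (iterDeriv f d) j (m + d) z = pderiv f j m (resize L z) ∧
      ∀ k : ℤ, m + d < k → pderiv (iterDeriv f d) j k z = 0 := by
  induction d with
  | zero =>
    intro z hz
    rw [show resize L z = z from resize_self (L := L) z] at hz ⊢
    simp only [Nat.cast_zero, add_zero]
    exact ⟨rfl, fun k hk => hm k hk z hz⟩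
  | succ d ih =>
    intro z hz
    have hz' : resize L (resize (L + d) z) ∈ U := by rwa [resize_resize (by omega)]
    have hV : IsOpen (resize L ⁻¹' U : Set (Jet n (L + d))) := hU.preimage (continuous_resize L)
    have ha := analyticOnNhd_iterDeriv hf d _ hz'
    -- Above order `m + d` the partial derivative vanishes on an open set, so its total derivative
    -- vanishes too and only the shifted term of the commutator remains.
    have key : ∀ k : ℤ, m + d < k → pderiv (iterDeriv f (d + 1)) j k z =
        pderiv (iterDeriv f d) j (k - 1) (resize (L + d) z) := by
      intro k hk
      have h0 := totalDeriv_eq_zero hV (fun y hy => (ih y hy).2 k hk) hz'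
      exact (pderiv_totalDeriv ha j k).trans (by rw [h0, zero_add])
    constructor
    · rw [key _ (by push_cast; omega), show m + ((d + 1 : ℕ) : ℤ) - 1 = m + d by push_cast; ring,
        (ih _ hz').1, resize_resize (by omega)]
    · intro k hk
      rw [key _ (by push_cast at hk; omega)]
      exact (ih _ hz').2 _ (by push_cast at hk; omega)

/-- The velocity of the jet curve is the direction occurring in `totalDeriv_eq_fderiv`: along a
trajectory the formal total derivative is the time derivative. -/
theorem hasDerivAt_jetOf {x : ℝ → Fin n → ℝ} {T : Set ℝ} (hT : IsOpen T)
    (hx : ContDiffOn ℝ ((⊤ : ℕ∞) : WithTop ℕ∞) x T) {t : ℝ} (ht : t ∈ T) (L : ℕ) :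
    HasDerivAt (DAE.jetOf L x) ((1, 0) + shiftL n L (DAE.jetOf (L + 1) x t)) t := by
  refine HasDerivAt.prodMk (by
    have h := hasDerivAt_id' t
    simpa [shiftL_apply] using h) (hasDerivAt_pi.2 fun c => ?_)
  have hc : ContDiffAt ℝ ((⊤ : ℕ∞) : WithTop ℕ∞) (fun s => x s c.1) t :=
    contDiffAt_pi.1 ((hx t ht).contDiffAt (hT.mem_nhds ht)) c.1
  have hd : DifferentiableAt ℝ (iteratedDeriv c.2 (fun s => x s c.1)) t := by
    have h := hc.contDiffWithinAt (s := Set.univ)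
    have h2 := h.differentiableWithinAt_iteratedDerivWithin (m := c.2)
      (by exact_mod_cast ENat.natCast_lt_top _) (by simp)
    rwa [iteratedDerivWithin_univ, differentiableWithinAt_univ] at h2
  have := hd.hasDerivAt
  rw [← iteratedDeriv_succ] at this
  convert this using 1
  simp [shiftL_apply, DAE.jetOf]

theorem resize_jetOf (h : L ≤ M) (x : ℝ → Fin n → ℝ) (t : ℝ) :
    resize L (DAE.jetOf M x t) = DAE.jetOf L x t := by
  refine Prod.ext rfl (funext fun c => ?_)
  have : (c.2 : ℕ) < M + 1 := by
    have := c.2.2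
    omega
  simp only [resize, dif_pos this, DAE.jetOf]

theorem iterDeriv_jetOf_eq_zero {f : Jet n L → ℝ} {U : Set (Jet n L)}
    (hf : AnalyticOnNhd ℝ f U) {x : ℝ → Fin n → ℝ} {T : Set ℝ} (hT : IsOpen T)
    (hx : ContDiffOn ℝ ((⊤ : ℕ∞) : WithTop ℕ∞) x T)
    (hs : ∀ t ∈ T, DAE.jetOf L x t ∈ U ∧ f (DAE.jetOf L x t) = 0) (d : ℕ) :
    ∀ t ∈ T, iterDeriv f d (DAE.jetOf (L + d) x t) = 0 := by
  induction d with
  | zero => exact fun t ht => (hs t ht).2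
  | succ d ih =>
    intro t ht
    have hmem : resize L (DAE.jetOf (L + d) x t) ∈ U := by
      rw [resize_jetOf (by omega)]
      exact (hs t ht).1
    have ha := (analyticOnNhd_iterDeriv hf d _ hmem).differentiableAt.hasFDerivAt
    have h1 := ha.comp_hasDerivAt t (hasDerivAt_jetOf hT hx ht (L + d))
    have h2 : HasDerivAt (iterDeriv f d ∘ DAE.jetOf (L + d) x) 0 t := by
      refine (hasDerivAt_const t (0 : ℝ)).congr_of_eventuallyEq ?_
      filter_upwards [hT.mem_nhds ht] with s hs' using ih s hs'
    refine (totalDeriv_eq_fderiv (iterDeriv f d) _).trans ?_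
    rw [resize_jetOf (show L + d ≤ L + (d + 1) by omega)]
    exact h1.unique h2

end JetCalculus

/-! ### The implicit function theorem on a product of open sets -/

section ImplicitFunction

open scoped ContDiff Topology

/-- The implicit function is given only near `u`. A box is obtained by fixing a ball `B`, which is
connected, and then shrinking `A` until `φ` is analytic on `A` and maps it into `B`. -/
theorem exists_analytic_implicit {E W G : Type*} [NormedAddCommGroup E] [NormedSpace ℝ E]
    [CompleteSpace E] [NormedAddCommGroup W] [NormedSpace ℝ W] [CompleteSpace W]
    [NormedAddCommGroup G] [NormedSpace ℝ G] [CompleteSpace G] {f : E × W → G} {u : E × W}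
    (hf : AnalyticAt ℝ f u) (hfu : f u = 0)
    (hinv : (fderiv ℝ f u ∘L .inr ℝ E W).IsInvertible) {N : Set (E × W)} (hN : N ∈ 𝓝 u) :
    ∃ A ∈ 𝓝 u.1, ∃ (B : Set W) (φ : E → W), IsOpen B ∧ IsConnected B ∧ u.2 ∈ B ∧ A ×ˢ B ⊆ N ∧
      AnalyticOnNhd ℝ φ A ∧ (∀ e ∈ A, φ e ∈ B) ∧
      ∀ e ∈ A, ∀ w ∈ B, f (e, w) = 0 ↔ w = φ e := by
  -- Class `ω` is analyticity, so the implicit function is analytic as well.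
  have cdf : ContDiffAt ℝ ω f u := hf.contDiffAt
  have hω : (ω : WithTop ℕ∞) ≠ 0 := by simp
  set φ := cdf.implicitFunction hω hinv with hφ
  have h1 := cdf.eventually_apply_eq_iff_implicitFunction hω hinv
  have h2 : AnalyticAt ℝ φ u.1 := (cdf.contDiffAt_implicitFunction hω hinv).analyticAt
  have h3 : φ u.1 = u.2 := cdf.implicitFunction_apply_self hω hinv
  obtain ⟨A, hA, B, hB, hAB⟩ := mem_nhds_prod_iff.1 (Filter.inter_mem h1 hN)
  obtain ⟨ε, hε, hball⟩ := Metric.mem_nhds_iff.1 hB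
  have h4 : ∀ᶠ e in 𝓝 u.1, φ e ∈ Metric.ball u.2 ε :=
    h2.continuousAt.eventually_mem (h3 ▸ Metric.ball_mem_nhds _ hε)
  have h5 := h2.eventually_analyticAt
  refine ⟨{e | e ∈ A ∧ φ e ∈ Metric.ball u.2 ε ∧ AnalyticAt ℝ φ e}, ?_, Metric.ball u.2 ε, φ,
    Metric.isOpen_ball, Metric.isConnected_ball hε, Metric.mem_ball_self hε, ?_,
    fun e he => he.2.2, fun e he => he.2.1, ?_⟩
  · filter_upwards [hA, h4, h5] with e a b c using ⟨a, b, c⟩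
  · rintro ⟨e, w⟩ ⟨he, hw⟩
    exact (hAB (Set.mk_mem_prod he.1 (hball hw))).2
  · intro e he w hw
    have := (hAB (Set.mk_mem_prod he.1 (hball hw))).1
    simp only [Set.mem_ofPred_eq, hfu] at this
    rw [this, eq_comm]

end ImplicitFunction

namespace DAE

/-! ### Gluing coordinates -/

section Glue

variable {n M : ℕ} {P : Fin n × Fin (M + 1) → Prop} [DecidablePred P]

theorem glue_restrict (x : Fin n × Fin (M + 1) → ℝ) :
    glue (P := P) (fun c => x c.1) (fun c => x c.1) = x := by
  funext c
  by_cases h : P c <;> simp [glue, h]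

variable (P) in
/-- The continuous linear map gluing `t`, the coordinates outside `P` and those in `P`. -/
def glueL : (ℝ × ({c // ¬ P c} → ℝ)) × ({c // P c} → ℝ) →L[ℝ] Jet n M :=
  LinearMap.toContinuousLinearMap
    { toFun := fun u => (u.1.1, glue u.1.2 u.2)
      map_add' := fun x y => by
        refine Prod.ext rfl (funext fun c => ?_)
        by_cases h : P c <;> simp [glue, h]
      map_smul' := fun a x => by
        refine Prod.ext rfl (funext fun c => ?_)
        by_cases h : P c <;> simp [glue, h] }

theorem glueL_inr (w : {c // P c} → ℝ) :
    glueL P (0, w) = ∑ c, w c • unitX c.1.1 c.1.2 := by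
  refine Prod.ext ?_ (funext fun c => ?_)
  · simp [unitX, Prod.fst_sum, glueL]
  · simp only [Prod.snd_sum, Finset.sum_apply, unitX, Prod.smul_snd, Pi.smul_apply,
      Pi.single_apply, smul_eq_mul, mul_ite, mul_one, mul_zero, Prod.mk.eta]
    change glue 0 w c = _
    by_cases h : P c
    · rw [Finset.sum_eq_single ⟨c, h⟩]
      · simp [glue, h]
      · intro b _ hb
        rw [if_neg]
        rintro rfl
        exact hb rfl
      · simp
    · rw [Finset.sum_eq_zero]
      · simp [glue, h]
      · intro b _
        rw [if_neg]
        rintro rfl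
        exact h b.2

end Glue

variable {n l : ℕ} (S : DAE n l) {p q : Fin n → ℤ} {r : Fin n} {I J : Finset (Fin n)}

/-! ### The Jacobian as a matrix of analytic functions -/

/-- Evaluation at a point. -/
def evalHom {E : Type*} [NormedAddCommGroup E] [NormedSpace ℝ E] {U : Set E} (z : U) :
    analyticRing U →+* ℝ :=
  (Pi.evalRingHom (fun _ : U => ℝ) z).comp (analyticRing U).subtype

theorem evalHom_apply {E : Type*} [NormedAddCommGroup E] [NormedSpace ℝ E] {U : Set E} (z : U)
    (a : analyticRing U) : evalHom z a = a.1 z := rfl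

/-- The system Jacobian as a matrix of analytic functions. -/
def jacRing (p q : Fin n → ℤ) : Matrix (Fin n) (Fin n) (analyticRing S.dom) :=
  Matrix.of fun i j =>
    restrict (pderiv (S.F i) j (q j - p i)) (analyticOnNhd_pderiv (S.analytic_F i) j _)

/-- Used for the embedding into the quotient field and for evaluation at a point; together they
relate nonsingularity over the field to nonvanishing of the determinant somewhere. -/
theorem map_sub_jacRing {R : Type*} [CommRing R] (g : analyticRing S.dom →+* R)
    (h : I.card = J.card) :
    g (sub (S.jacRing p q) I J h).det = (sub ((S.jacRing p q).map g) I J h).det := by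
  rw [RingHom.map_det]
  rfl

theorem det_sub_jac (h : I.card = J.card) :
    (sub (S.jac p q) I J h).det = algebraMap _ S.K (sub (S.jacRing p q) I J h).det :=
  (S.map_sub_jacRing (algebraMap (analyticRing S.dom) S.K) h).symm

theorem det_sub_jacAt (h : I.card = J.card) (z : S.dom) :
    (sub (S.jacAt p q z) I J h).det = (sub (S.jacRing p q) I J h).det.1 z :=
  (S.map_sub_jacRing (evalHom z) h).symm

theorem exists_det_sub_jacAt_ne_zero {h : I.card = J.card}
    (hdet : (sub (S.jac p q) I J h).det ≠ 0) :
    ∃ z ∈ S.dom, (sub (S.jacAt p q z) I J h).det ≠ 0 := by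
  by_contra! hz
  apply hdet
  rw [det_sub_jac]
  rw [show (sub (S.jacRing p q) I J h).det = 0 from ?_, map_zero]
  refine Subtype.ext (funext fun z => ?_)
  rw [← det_sub_jacAt, hz z z.2]
  rfl

/-! ### The Jacobian of the differentiated equations. -/

theorem pderiv_F_eq_zero (hpq : S.DualFeasible p q) (i j : Fin n) (k : ℤ) (hk : q j - p i < k)
    (z : Jet n l) (hz : z ∈ S.dom) : pderiv (S.F i) j k z = 0 := by
  by_contra hne
  have hr : 0 ≤ k ∧ k.toNat < l + 1 := by
    by_contra hr
    exact hne (by rw [pderiv, dif_neg hr])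
  rw [pderiv, dif_pos hr] at hne
  have hle : ((k : ℤ) : WithBot ℤ) ≤ S.c i j := by
    classical
    have hmem : (⟨k.toNat, hr.2⟩ : Fin (l + 1)) ∈ Finset.univ.filter
        (fun k : Fin (l + 1) => ∃ z ∈ S.dom, fderiv ℝ (S.F i) z (unitX j k) ≠ 0) := by
      exact Finset.mem_filter.2 ⟨Finset.mem_univ _, z, hz, hne⟩
    have := Finset.le_sup (f := fun k : Fin (l + 1) => (((k : ℕ) : ℤ) : WithBot ℤ)) hmem
    simp only [Int.toNat_of_nonneg hr.1] at this
    unfold c ord maxOrder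
    convert this
  have hne' : S.c i j ≠ ⊥ := fun h => by simp [h] at hle
  have := hle.trans (hpq i j hne')
  rw [WithBot.coe_le_coe] at this
  omega

theorem resize_mem_dom {d e : ℕ} {z : Jet n (l + e)} (hz : z ∈ S.domExt e) :
    resize l (resize (l + d) z) ∈ S.dom := by
  rw [resize_resize (by omega)]
  exact hz

/-- By feasibility `q_j - p_i` bounds the order of `x_j` in `F_i`; after `d = p_i - p_r`
differentiations the bound is `q_j - p_r`, with the same leading derivative. -/
theorem pderiv_dF (hpq : S.DualFeasible p q) {d e : ℕ} (hde : d ≤ e) {i : Fin n}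
    (hd : (d : ℤ) = p i - p r) (j : Fin n) {z : Jet n (l + e)} (hz : z ∈ S.domExt e) :
    pderiv (S.dF i d e) j (q j - p r) z = S.jacAt p q (resize l z) i j := by
  have hz' := S.resize_mem_dom (d := d) hz
  have ha := (analyticOnNhd_iterDeriv (S.analytic_F i) d _ hz').differentiableAt
  have h1 : pderiv (S.dF i d e) j (q j - p r) z =
      pderiv (iterDeriv (S.F i) d) j (q j - p r) (resize (l + d) z) := by
    rw [pderiv_eq_fderiv, pderiv_eq_fderiv, ← resize_unitZ (show l + d ≤ l + e by omega)]
    exact fderiv_comp_resize ha _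
  have h2 := (pderiv_iterDeriv S.isOpen_dom (S.analytic_F i)
    (fun k hk y hy => S.pderiv_F_eq_zero hpq i j k hk y hy) d _ hz').1
  rw [show q j - p i + (d : ℤ) = q j - p r by omega, resize_resize (by omega)] at h2
  rw [h1, h2]
  rfl

theorem toNat_le_kappa {i : Fin n} (hi : i ∈ I) : (p i - p r).toNat ≤ kappa p r I :=
  Finset.le_sup (f := fun i => (p i - p r).toNat) hi

theorem sub_pderiv_dF (hpq : S.DualFeasible p q) (hle : ∀ i ∈ I, p r ≤ p i) (h : I.card = J.card)
    {z : Jet n (l + kappa p r I)} (hz : z ∈ S.domExt (kappa p r I)) :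
    sub (Matrix.of fun i j =>
      pderiv (S.dF i (p i - p r).toNat (kappa p r I)) j (q j - p r) z) I J h =
    sub (S.jacAt p q (resize l z)) I J h := by
  ext a b
  have ha : I.orderEmbOfFin rfl a ∈ I := I.orderEmbOfFin_mem rfl a
  exact S.pderiv_dF hpq (toNat_le_kappa ha)
    (Int.toNat_of_nonneg (sub_nonneg.2 (hle _ ha))) _ hz

/-- A column of a nonsingular matrix has a nonzero entry, so `0 ≤ q_j - p_i ≤ l` for some `i ∈ I`;
adding `p_i - p_r`, which lies between `0` and `κ`, gives the range. Thus every `j ∈ J` does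
contribute a solved coordinate. -/
theorem order_mem_range (hle : ∀ i ∈ I, p r ≤ p i) {h : I.card = J.card} {z : Jet n l}
    (hdet : (sub (S.jacAt p q z) I J h).det ≠ 0) (b : Fin I.card) :
    0 ≤ q (J.orderEmbOfFin h.symm b) - p r ∧
      (q (J.orderEmbOfFin h.symm b) - p r).toNat < l + kappa p r I + 1 := by
  have : ∃ a, sub (S.jacAt p q z) I J h a b ≠ 0 := by
    by_contra! h0
    exact hdet (Matrix.det_eq_zero_of_column_eq_zero b h0)
  obtain ⟨a, ha⟩ := this
  have hI : I.orderEmbOfFin rfl a ∈ I := I.orderEmbOfFin_mem rfl a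
  have h1 := hle _ hI
  have h2 := toNat_le_kappa (p := p) (r := r) hI
  have hr : 0 ≤ q (J.orderEmbOfFin h.symm b) - p (I.orderEmbOfFin rfl a) ∧
      (q (J.orderEmbOfFin h.symm b) - p (I.orderEmbOfFin rfl a)).toNat < l + 1 := by
    by_contra hr
    exact ha (dif_neg hr)
  omega

/-- The solved coordinates, numbered by the columns of `D[I, J]`. -/
def solvedEquiv (p q : Fin n → ℤ) (r : Fin n) (I J : Finset (Fin n)) (h : I.card = J.card) (M : ℕ)
    (hr : ∀ b : Fin I.card, 0 ≤ q (J.orderEmbOfFin h.symm b) - p r ∧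
      (q (J.orderEmbOfFin h.symm b) - p r).toNat < M + 1) :
    Fin I.card ≃ {c : Fin n × Fin (M + 1) // IsSolved p q r J c} :=
  Equiv.ofBijective
    (fun b => ⟨(J.orderEmbOfFin h.symm b, ⟨(q (J.orderEmbOfFin h.symm b) - p r).toNat, (hr b).2⟩),
      J.orderEmbOfFin_mem h.symm b, Int.toNat_of_nonneg (hr b).1⟩) (by
    constructor
    · intro a b hab
      exact (J.orderEmbOfFin h.symm).injective (congrArg (fun c => c.1.1) hab)
    · rintro ⟨⟨j, k⟩, hj, hk⟩
      obtain ⟨b, rfl⟩ : j ∈ Set.range (J.orderEmbOfFin h.symm) := by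
        rw [Finset.range_orderEmbOfFin]
        exact hj
      refine ⟨b, Subtype.ext (Prod.ext rfl (Fin.ext ?_))⟩
      simp only at hk ⊢
      omega)

theorem unitX_solved {M : ℕ} {c : Fin n × Fin (M + 1)} (hc : IsSolved p q r J c) :
    unitX c.1 c.2 = unitZ M c.1 (q c.1 - p r) := by
  rw [← hc.2, unitZ_natCast]

/-- A consistent point lifts to a point where all derivatives of the equations vanish. -/
theorem exists_lift_consistent {z : Jet n l} (hz : S.IsConsistentPoint z) (e : ℕ) :
    ∃ y : Jet n (l + e), y ∈ S.domExt e ∧ resize l y = z ∧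
      ∀ i, ∀ d ≤ e, S.dF i d e y = 0 := by
  obtain ⟨T, x, hT, -, -, hzT, hx, hsol, hxz⟩ := hz
  have hres : resize l (jetOf (l + e) x z.1) = z := by
    rw [resize_jetOf (by omega), hxz]
  refine ⟨jetOf (l + e) x z.1, ?_, hres, ?_⟩
  · change resize l (jetOf (l + e) x z.1) ∈ S.dom
    rw [hres, ← hxz]
    exact (hsol _ hzT).1
  · intro i d hd
    rw [dF, resize_jetOf (by omega)]
    exact iterDeriv_jetOf_eq_zero (S.analytic_F i) hT hx
      (fun t ht => ⟨(hsol t ht).1, (hsol t ht).2 i⟩) d _ hzT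

/-! ### Existence of an explicit function -/

section Existence

open scoped Topology

theorem isOpen_domExt (e : ℕ) : IsOpen (S.domExt e) :=
  S.isOpen_dom.preimage (continuous_resize l)

theorem isOpen_setOf_det_ne_zero (h : I.card = J.card) :
    IsOpen {z | z ∈ S.dom ∧ (sub (S.jacAt p q z) I J h).det ≠ 0} := by
  have hc : ContinuousOn (fun z => (sub (S.jacAt p q z) I J h).det) S.dom := by
    refine (Continuous.matrix_det continuous_id).comp_continuousOn ?_
    refine continuousOn_pi.2 fun a => continuousOn_pi.2 fun b => ?_
    exact (analyticOnNhd_pderiv (S.analytic_F _) _ _).continuousOn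
  exact hc.isOpen_inter_preimage S.isOpen_dom isOpen_compl_singleton

theorem isInvertible_of_solvedEquiv {M : ℕ} {P : Fin n × Fin (M + 1) → Prop} [DecidablePred P]
    {m : ℕ} (σ : Fin m ≃ {c // P c}) {A : Matrix (Fin m) (Fin m) ℝ} (hA : A.det ≠ 0)
    {T : ({c // P c} → ℝ) →L[ℝ] (Fin m → ℝ)} (hT : ∀ w a, T w a = ∑ b, A a b * w (σ b)) :
    T.IsInvertible := by
  let e : ({c // P c} → ℝ) ≃ₗ[ℝ] (Fin m → ℝ) :=
    (LinearEquiv.funCongrLeft ℝ ℝ σ).trans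
      (Matrix.toLinearEquiv' A (A.invertibleOfIsUnitDet (isUnit_iff_ne_zero.2 hA)))
  refine ⟨e.toContinuousLinearEquiv, ?_⟩
  ext w a
  rw [hT]
  rfl

theorem nonempty_explicitFunction (hpq : S.DualFeasible p q) (hle : ∀ i ∈ I, p r ≤ p i)
    (h : I.card = J.card) {z : Jet n l} (hz : S.IsConsistentPoint z)
    (hdet : (sub (S.jacAt p q z) I J h).det ≠ 0) :
    Nonempty (S.ExplicitFunction p q r I J h) := by
  set κ := kappa p r I with hκ
  obtain ⟨y, hy, hyz, hzero⟩ := S.exists_lift_consistent hz κ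
  let P : Fin n × Fin (l + κ + 1) → Prop := IsSolved p q r J
  let v₀ : {c // ¬ P c} → ℝ := fun c => y.2 c.1
  let w₀ : {c // P c} → ℝ := fun c => y.2 c.1
  let u : (ℝ × ({c // ¬ P c} → ℝ)) × ({c // P c} → ℝ) := ((y.1, v₀), w₀)
  have hu : glueL P u = y := Prod.ext rfl (glue_restrict y.2)
  let G : Jet n (l + κ) → Fin I.card → ℝ := fun y a =>
    S.dF (I.orderEmbOfFin rfl a) (p (I.orderEmbOfFin rfl a) - p r).toNat κ y
  have hG : ∀ y ∈ S.domExt κ, AnalyticAt ℝ G y := fun y hy =>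
    analyticAt_pi_iff.2 fun a => S.analyticOnNhd_dF _ _ _ y hy
  have hf : AnalyticAt ℝ (fun x => G (glueL P x)) u :=
    AnalyticAt.comp (g := G) (by rw [hu]; exact hG y hy) ((glueL P).analyticAt u)
  have hfu : G (glueL P u) = 0 := by
    rw [hu]
    exact funext fun a => hzero _ _ (toNat_le_kappa (I.orderEmbOfFin_mem rfl a))
  have hdet' : (sub (Matrix.of fun i j =>
      pderiv (S.dF i (p i - p r).toNat κ) j (q j - p r) y) I J h).det ≠ 0 := by
    rw [S.sub_pderiv_dF hpq hle h hy, hyz]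
    exact hdet
  have hinv : (fderiv ℝ (fun x => G (glueL P x)) u ∘L
      .inr ℝ (ℝ × ({c // ¬ P c} → ℝ)) ({c // P c} → ℝ)).IsInvertible := by
    refine isInvertible_of_solvedEquiv
      (solvedEquiv p q r I J h (l + κ) (order_mem_range S hle hdet)) hdet' fun w a => ?_
    have hGd : HasFDerivAt G (fderiv ℝ G y) y := (hG y hy).differentiableAt.hasFDerivAt
    have hcomp : HasFDerivAt (fun x => G (glueL P x)) ((fderiv ℝ G y).comp (glueL P)) u :=
      HasFDerivAt.comp u (g := G) (by rw [hu]; exact hGd) (glueL P).hasFDerivAt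
    have hGa : ∀ v, fderiv ℝ G y v a = fderiv ℝ (fun x => G x a) y v := fun v =>
      congrArg (fun T => T v) ((hasFDerivAt_pi'.1 hGd) a).fderiv.symm
    rw [hcomp.fderiv]
    change fderiv ℝ G y (glueL P (0, w)) a = _
    rw [hGa, glueL_inr, map_sum]
    rw [← (solvedEquiv p q r I J h (l + κ) (order_mem_range S hle hdet)).sum_comp]
    refine Finset.sum_congr rfl fun b _ => ?_
    rw [map_smul, smul_eq_mul, mul_comm, unitX_solved (Subtype.prop _), ← pderiv_eq_fderiv]
    rfl
  -- Keeping the box inside the set where `det D[I, J] ≠ 0` gives nonsingularity at all its points,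
  -- not only at `y`.
  let N : Set (Jet n (l + κ)) := S.domExt κ ∩
    resize l ⁻¹' {z | z ∈ S.dom ∧ (sub (S.jacAt p q z) I J h).det ≠ 0}
  have hN : IsOpen N := (S.isOpen_domExt κ).inter
    ((S.isOpen_setOf_det_ne_zero h).preimage (continuous_resize l))
  have hyN : y ∈ N := ⟨hy, hy, by rw [hyz]; exact hdet⟩
  obtain ⟨A, hA, B, φ, hBo, hBc, -, hAB, hφ, hmaps, hiff⟩ := exists_analytic_implicit hf hfu hinv
    ((hN.preimage (glueL P).continuous).mem_nhds (show glueL P u ∈ N by rwa [hu]))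
  obtain ⟨T', V, hTo, hT, hVo, hV, hTV⟩ := mem_nhds_prod_iff'.1 hA
  have hmem : ∀ t ∈ T', ∀ v ∈ V, ∀ w ∈ B, (t, glue v w) ∈ N := fun t ht v hv w hw =>
    hAB (Set.mk_mem_prod (hTV (Set.mk_mem_prod ht hv)) hw)
  exact ⟨{
    T' := T'
    V := V
    W := B
    φ := φ
    isOpen_T' := hTo
    isOpen_V := hVo
    isOpen_W := hBo
    nonempty_T' := ⟨_, hT⟩
    nonempty_V := ⟨_, hV⟩
    isConnected_W := hBc
    subset_dom := fun t ht v hv w hw => (hmem t ht v hv w hw).1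
    mapsTo := fun t ht v hv => hmaps _ (hTV (Set.mk_mem_prod ht hv))
    analytic := hφ.mono hTV
    eq_zero_iff := fun t ht v hv w hw => by
      rw [← hiff _ (hTV (Set.mk_mem_prod ht hv)) w hw]
      constructor
      · exact fun h0 => funext fun a => h0 _ (I.orderEmbOfFin_mem rfl a)
      · intro h0 i hi
        obtain ⟨a, rfl⟩ : i ∈ Set.range (I.orderEmbOfFin rfl) := by
          rw [Finset.range_orderEmbOfFin]
          exact hi
        exact congrFun h0 a
    nonsingular := fun t ht v hv => by
      have hm := hmem t ht v hv _ (hmaps _ (hTV (Set.mk_mem_prod ht hv)))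
      rw [S.sub_pderiv_dF hpq hle h hm.1]
      exact hm.2.2 }⟩

end Existence
end DAE

/-! ### Directional derivatives in the ring of analytic functions -/

section RingDeriv

open scoped Topology

variable {E : Type*} [NormedAddCommGroup E] [NormedSpace ℝ E] {U : Set E}

/-- As `U` is open, the zero extension of `a` agrees with `g` near each point of `U`. -/
theorem ringDeriv_eq_fderiv (hU : IsOpen U) {a : analyticRing U} {g : E → ℝ}
    (hga : ∀ x : U, a.1 x = g x) (v : E) (x : U) : ringDeriv v a x = fderiv ℝ g x v := by
  have : Function.extend Subtype.val a.1 0 =ᶠ[𝓝 (x : E)] g := by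
    filter_upwards [hU.mem_nhds x.2] with y hy
    rw [← hga ⟨y, hy⟩]
    exact Subtype.val_injective.extend_apply a.1 0 ⟨y, hy⟩
  rw [ringDeriv, this.fderiv_eq]

/-- The derivative in the direction `v` as a map of the ring of analytic functions to itself. -/
def derivRing (hU : IsOpen U) (v : E) (a : analyticRing U) : analyticRing U :=
  ⟨ringDeriv v a, by
    obtain ⟨g, hg, hga⟩ := a.2
    exact ⟨fun z => fderiv ℝ g z v, analyticOnNhd_fderiv_apply hg v,
      ringDeriv_eq_fderiv hU hga v⟩⟩

theorem derivRing_mul (hU : IsOpen U) (v : E) (a b : analyticRing U) :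
    derivRing hU v (a * b) = derivRing hU v a * b + a * derivRing hU v b := by
  obtain ⟨g, hg, hga⟩ := a.2
  obtain ⟨h, hh, hhb⟩ := b.2
  refine Subtype.ext (funext fun x => ?_)
  have hab : ∀ x : U, (a * b).1 x = (g * h) x := fun x => by
    change a.1 x * b.1 x = g x * h x
    rw [hga, hhb]
  change ringDeriv v (a * b) x = ringDeriv v a x * b.1 x + a.1 x * ringDeriv v b x
  rw [ringDeriv_eq_fderiv hU hab, ringDeriv_eq_fderiv hU hga, ringDeriv_eq_fderiv hU hhb, hga, hhb,
    fderiv_mul (hg x x.2).differentiableAt (hh x x.2).differentiableAt]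
  simp only [add_apply, smul_apply, smul_eq_mul]
  ring

theorem quotient_rule_of_eq {R : Type*} [CommRing R] {a b A B da db dA dB : R}
    (hAB : a * B = A * b) (hd : da * B + a * dB = dA * b + A * db) (h : da * b = a * db) :
    b * b * (dA * B) = b * b * (A * dB) := by
  linear_combination (-b * B) * hd + B * B * h + (B * db + b * dB) * hAB

theorem quotient_rule_div {R : Type*} [CommRing R] {a b c d da db dc dd : R}
    (h₁ : da * b = a * db) (h₂ : dc * d = c * dd) :
    (da * d + a * dd) * (b * c) = a * d * (db * c + b * dc) := by
  linear_combination (c * d) * h₁ - (a * b) * h₂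

/-- The derivative of the quotient `f` in the direction `v` vanishes. -/
def FracConst (hU : IsOpen U) (v : E) (f : FractionRing (analyticRing U)) : Prop :=
  ∀ a b : analyticRing U, b ≠ 0 →
    f * algebraMap _ (FractionRing (analyticRing U)) b = algebraMap _ _ a →
      derivRing hU v a * b = a * derivRing hU v b

/-- A single representation `a / b` suffices: differentiating `a B = A b` transfers the condition to
any other one, up to a factor `b²` that cancels in a domain. -/
theorem FracConst.of_eq [IsDomain (analyticRing U)] (hU : IsOpen U) {v : E}
    {f : FractionRing (analyticRing U)} {a b : analyticRing U} (hb : b ≠ 0)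
    (hf : f * algebraMap _ (FractionRing (analyticRing U)) b = algebraMap _ _ a)
    (h : derivRing hU v a * b = a * derivRing hU v b) : FracConst hU v f := by
  intro A B hB hf'
  have hinj := IsFractionRing.injective (analyticRing U) (FractionRing (analyticRing U))
  have hAB : a * B = A * b := by
    apply hinj
    rw [map_mul, map_mul, ← hf, ← hf', mul_right_comm]
  have hd := congrArg (derivRing hU v) hAB
  rw [derivRing_mul, derivRing_mul] at hd
  apply mul_left_cancel₀ (mul_ne_zero hb hb)
  exact quotient_rule_of_eq hAB hd h

theorem FracConst.div [IsDomain (analyticRing U)] {hU : IsOpen U} {v : E}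
    {f g : FractionRing (analyticRing U)} (hg : g ≠ 0) (hf : FracConst hU v f)
    (hg' : FracConst hU v g) : FracConst hU v (f / g) := by
  obtain ⟨a, b, hb, rfl⟩ := IsFractionRing.div_surjective (A := analyticRing U) f
  obtain ⟨c, d, hd, rfl⟩ := IsFractionRing.div_surjective (A := analyticRing U) g
  have hb := nonZeroDivisors.ne_zero hb
  have hd := nonZeroDivisors.ne_zero hd
  have hb' : algebraMap (analyticRing U) (FractionRing (analyticRing U)) b ≠ 0 := by simpa using hb
  have hd' : algebraMap (analyticRing U) (FractionRing (analyticRing U)) d ≠ 0 := by simpa using hd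
  have hc' : algebraMap (analyticRing U) (FractionRing (analyticRing U)) c ≠ 0 := by
    intro h0
    exact hg (by rw [h0, zero_div])
  have hc : c ≠ 0 := fun h0 => hc' (by rw [h0, map_zero])
  have h1 := hf a b hb (div_mul_cancel₀ _ hb')
  have h2 := hg' c d hd (div_mul_cancel₀ _ hd')
  refine FracConst.of_eq hU (a := a * d) (b := b * c) (mul_ne_zero hb hc) ?_ ?_
  · rw [map_mul, map_mul]
    field_simp
  · rw [derivRing_mul, derivRing_mul]
    exact quotient_rule_div h1 h2

/-- All integers `k ≥ m` may be allowed, since `unitZ` is zero out of range. -/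
theorem fracOrd_lt_iff {n L : ℕ} {U : Set (Jet n L)} (hU : IsOpen U)
    (f : FractionRing (analyticRing U)) (j : Fin n) (m : ℤ) :
    fracOrd f j < (m : WithBot ℤ) ↔ ∀ k : ℤ, m ≤ k → FracConst hU (unitZ L j k) f := by
  classical
  unfold fracOrd maxOrder
  rw [Finset.sup_lt_iff (WithBot.bot_lt_coe m)]
  constructor
  · intro h k hk a b hb hab
    refine Subtype.ext (funext fun z => ?_)
    change ringDeriv _ a z * b.1 z = a.1 z * ringDeriv _ b z
    by_cases hr : 0 ≤ k ∧ k.toNat < L + 1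
    · by_contra hne
      have hu := unitZ_natCast j (⟨k.toNat, hr.2⟩ : Fin (L + 1))
      simp only [Int.toNat_of_nonneg hr.1] at hu
      rw [hu] at hne
      have := h ⟨k.toNat, hr.2⟩
        (Finset.mem_filter.2 ⟨Finset.mem_univ _, a, b, hb, hab, z, hne⟩)
      rw [WithBot.coe_lt_coe] at this
      simp only at this
      omega
    · rw [unitZ_eq_zero hr]
      simp [ringDeriv]
  · intro h k hk
    obtain ⟨-, a, b, hb, hab, z, hne⟩ := Finset.mem_filter.1 hk
    rw [WithBot.coe_lt_coe]
    by_contra hlt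
    have := congrFun (congrArg Subtype.val (h k (not_lt.1 hlt) a b hb hab)) z
    rw [unitZ_natCast] at this
    exact hne this

end RingDeriv

namespace DAE

variable {n l : ℕ} (S : DAE n l) {p q : Fin n → ℤ} {r : Fin n} {I J : Finset (Fin n)}

/-! ### The cokernel of the system Jacobian -/

theorem mem_supp {u : Fin n → S.K} {i : Fin n} : i ∈ S.supp u ↔ u i ≠ 0 := by
  classical
  simp [supp]

theorem sum_eq_add_sum_orderEmb {R : Type*} [AddCommMonoid R] (hr : r ∉ I) (x : Fin n → R)
    (hx : ∀ i, i ∉ insert r I → x i = 0) :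
    ∑ i, x i = x r + ∑ a, x (I.orderEmbOfFin rfl a) := by
  rw [← Finset.sum_subset (Finset.subset_univ (insert r I)) fun i _ hi => hx i hi,
    Finset.sum_insert hr]
  congr 1
  conv_lhs => rw [← Finset.map_orderEmbOfFin_univ I rfl]
  rw [Finset.sum_map]
  rfl

/-- The rows in `I` are independent because their restrictions to the columns `J` are. By the rank
condition they already span the row space of `I ∪ {r}`. -/
theorem exists_row_eq {K : Type*} [Field K] {D : Matrix (Fin n) (Fin n) K} {h : I.card = J.card}
    (hdet : (sub D I J h).det ≠ 0)
    (hrank : (D.submatrix (fun i : ↥(insert r I) => (i : Fin n)) id).rank = I.card) :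
    ∃ x : Fin I.card → K, ∀ j, D r j = ∑ a, x a * D (I.orderEmbOfFin rfl a) j := by
  have hli : LinearIndependent K (fun a => D (I.orderEmbOfFin rfl a)) := by
    have h1 : LinearIndependent K (sub D I J h).row :=
      Matrix.linearIndependent_rows_iff_isUnit.2
        ((Matrix.isUnit_iff_isUnit_det _).2 (isUnit_iff_ne_zero.2 hdet))
    exact LinearIndependent.of_comp (LinearMap.funLeft K K (J.orderEmbOfFin h.symm)) h1
  have hle : Submodule.span K (Set.range fun a => D (I.orderEmbOfFin rfl a)) ≤
      Submodule.span K (Set.range (D.submatrix (fun i : ↥(insert r I) => (i : Fin n)) id).row) := by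
    refine Submodule.span_mono ?_
    rintro _ ⟨a, rfl⟩
    exact ⟨⟨_, Finset.mem_insert_of_mem (I.orderEmbOfFin_mem rfl a)⟩, rfl⟩
  have heq := Submodule.eq_of_le_of_finrank_eq hle (by
    rw [← Matrix.rank_eq_finrank_span_row, hrank, finrank_span_eq_card hli, Fintype.card_fin])
  have hmem : D r ∈ Submodule.span K (Set.range fun a => D (I.orderEmbOfFin rfl a)) := by
    rw [heq]
    exact Submodule.subset_span ⟨⟨r, Finset.mem_insert_self r I⟩, rfl⟩
  obtain ⟨x, hx⟩ := (Submodule.mem_span_range_iff_exists_fun K).1 hmem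
  refine ⟨x, fun j => ?_⟩
  rw [← hx]
  simp [Finset.sum_apply]

/-! ### The special vector spans the cokernel vectors supported in `I ∪ {r}`. -/

section SpecialVector

variable {h : I.card = J.card}

theorem specialVector_self : S.specialVector p q r I J h r = 1 := by simp [specialVector]

theorem specialVector_orderEmb (hr : r ∉ I) (a : Fin I.card) :
    S.specialVector p q r I J h (I.orderEmbOfFin rfl a) =
      -((fun b => S.jac p q r (J.orderEmbOfFin h.symm b)) ᵥ* (sub (S.jac p q) I J h)⁻¹) a := by
  have ha : I.orderEmbOfFin rfl a ∈ I := I.orderEmbOfFin_mem rfl a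
  have hne : I.orderEmbOfFin rfl a ≠ r := fun h0 => hr (h0 ▸ ha)
  have hsymm : (I.orderIsoOfFin rfl).symm ⟨I.orderEmbOfFin rfl a, ha⟩ = a := by
    rw [OrderIso.symm_apply_eq]
    rfl
  rw [specialVector, if_neg hne, dif_pos ha, hsymm]
  rfl

theorem specialVector_eq_zero {i : Fin n} (hi : i ∉ insert r I) :
    S.specialVector p q r I J h i = 0 := by
  rw [Finset.mem_insert, not_or] at hi
  rw [specialVector, if_neg hi.1, dif_neg hi.2]

theorem vecMul_jac_apply (hr : r ∉ I) {v : Fin n → S.K} (hv : ∀ i, i ∉ insert r I → v i = 0)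
    (j : Fin n) : (v ᵥ* S.jac p q) j =
      v r * S.jac p q r j + ∑ a, v (I.orderEmbOfFin rfl a) * S.jac p q (I.orderEmbOfFin rfl a) j :=
  sum_eq_add_sum_orderEmb hr (fun i => v i * S.jac p q i j) fun i hi => by rw [hv i hi, zero_mul]

/-- The columns `J` alone determine the coefficients of row `r` in the rows of `I`: they are `D[{r},
J] D[I, J]⁻¹`. The relation then holds in all columns. -/
theorem isCokernel_specialVector (hr : r ∉ I) (hdet : (sub (S.jac p q) I J h).det ≠ 0)
    (hrank : ((S.jac p q).submatrix (fun i : ↥(insert r I) => (i : Fin n)) id).rank = I.card) :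
    S.IsCokernel p q (S.specialVector p q r I J h) := by
  obtain ⟨x, hx⟩ := exists_row_eq hdet hrank
  have hxJ : (fun b => S.jac p q r (J.orderEmbOfFin h.symm b)) = x ᵥ* sub (S.jac p q) I J h :=
    funext fun b => hx _
  have hx' : (fun b => S.jac p q r (J.orderEmbOfFin h.symm b)) ᵥ* (sub (S.jac p q) I J h)⁻¹ = x := by
    rw [hxJ, Matrix.vecMul_vecMul, Matrix.mul_nonsing_inv _ (isUnit_iff_ne_zero.2 hdet),
      Matrix.vecMul_one]
  refine funext fun j => ?_
  rw [S.vecMul_jac_apply hr fun i hi => S.specialVector_eq_zero hi]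
  simp only [S.specialVector_orderEmb hr, hx', specialVector_self, hx j, one_mul, neg_mul,
    Finset.sum_neg_distrib, add_neg_cancel, Pi.zero_apply]

/-- The columns `J` of `vD = 0` read `v_I D[I, J] = -v_r D[{r}, J]`, which can be solved for `v_I`.
-/
theorem eq_mul_specialVector (hr : r ∉ I) (hdet : (sub (S.jac p q) I J h).det ≠ 0)
    {v : Fin n → S.K} (hv : S.IsCokernel p q v) (hsupp : ∀ i, i ∉ insert r I → v i = 0)
    (i : Fin n) : v i = v r * S.specialVector p q r I J h i := by
  have hvI : (fun a => v (I.orderEmbOfFin rfl a)) ᵥ* sub (S.jac p q) I J h =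
      -(v r • fun b => S.jac p q r (J.orderEmbOfFin h.symm b)) := by
    refine funext fun b => ?_
    have h1 := congrFun hv (J.orderEmbOfFin h.symm b)
    rw [S.vecMul_jac_apply hr hsupp, Pi.zero_apply, add_comm] at h1
    exact eq_neg_of_add_eq_zero_left h1
  have hvI' := congrArg (· ᵥ* (sub (S.jac p q) I J h)⁻¹) hvI
  simp only [Matrix.vecMul_vecMul, Matrix.mul_nonsing_inv _ (isUnit_iff_ne_zero.2 hdet),
    Matrix.vecMul_one, Matrix.neg_vecMul, Matrix.smul_vecMul] at hvI'
  by_cases hi : i ∈ insert r I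
  · rcases Finset.mem_insert.1 hi with rfl | hi
    · rw [specialVector_self, mul_one]
    · obtain ⟨a, rfl⟩ : i ∈ Set.range (I.orderEmbOfFin rfl) := by
        rw [Finset.range_orderEmbOfFin]
        exact hi
      rw [S.specialVector_orderEmb hr, mul_neg]
      exact congrFun hvI' a
  · rw [hsupp i hi, S.specialVector_eq_zero hi, mul_zero]

/-- Cramer's rule: `det D[I, J]` is a common denominator of the special vector. -/
theorem exists_numerator (hr : r ∉ I) (hdet : (sub (S.jac p q) I J h).det ≠ 0) :
    ∃ a : Fin n → analyticRing S.dom, ∀ i, S.specialVector p q r I J h i *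
      algebraMap _ S.K (sub (S.jacRing p q) I J h).det = algebraMap _ S.K (a i) := by
  refine Classical.axiom_of_choice (r := fun i a => S.specialVector p q r I J h i *
      algebraMap _ S.K (sub (S.jacRing p q) I J h).det = algebraMap _ S.K a) fun i => ?_
  by_cases hi : i ∈ insert r I
  · rcases Finset.mem_insert.1 hi with rfl | hi
    · exact ⟨_, by rw [specialVector_self, one_mul]⟩
    · obtain ⟨a, rfl⟩ : i ∈ Set.range (I.orderEmbOfFin rfl) := by
        rw [Finset.range_orderEmbOfFin]
        exact hi
      have hadj : (sub (S.jac p q) I J h)⁻¹ = ((sub (S.jac p q) I J h).det)⁻¹ •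
          (sub (S.jacRing p q) I J h).adjugate.map (algebraMap (analyticRing S.dom) S.K) := by
        rw [Matrix.inv_def, Ring.inverse_eq_inv']
        congr 1
        exact (RingHom.map_adjugate (algebraMap (analyticRing S.dom) S.K) _).symm
      refine ⟨-∑ b, S.jacRing p q r (J.orderEmbOfFin h.symm b) *
        (sub (S.jacRing p q) I J h).adjugate b a, ?_⟩
      rw [S.specialVector_orderEmb hr, hadj, Matrix.vecMul_smul, Pi.smul_apply, smul_eq_mul,
        ← det_sub_jac, neg_mul, mul_right_comm, inv_mul_cancel₀ hdet, one_mul, map_neg, map_sum]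
      simp only [map_mul]
      rfl
  · exact ⟨0, by rw [S.specialVector_eq_zero hi, zero_mul, map_zero]⟩

theorem isPivot_specialVector (hle : ∀ i ∈ I, p r ≤ p i) :
    S.IsPivot p (S.specialVector p q r I J h) r := by
  refine ⟨S.mem_supp.2 (by
    have : Nontrivial S.K := IsFractionRing.nontrivial (analyticRing S.dom) S.K
    rw [specialVector_self]
    exact @one_ne_zero S.K _ _ (@NeZero.one S.K _ this)), fun i hi => ?_⟩
  have hi' : i ∈ insert r I := by
    by_contra hni
    exact S.mem_supp.1 hi (S.specialVector_eq_zero hni)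
  rcases Finset.mem_insert.1 hi' with rfl | hi'
  · exact le_rfl
  · exact hle i hi'

/-- Since `u_i = v_i / v_r`, and validity covers the entry `v_r` too, numerator and denominator both
have zero derivative in the relevant directions. -/
theorem lcValid_specialVector (hr : r ∉ I) (hdet : (sub (S.jac p q) I J h).det ≠ 0)
    {v : Fin n → S.K} (hv : S.IsCokernel p q v) (hsupp : S.supp v = insert r I)
    (hvalid : S.LCValid p q r v) : S.LCValid p q r (S.specialVector p q r I J h) := by
  have hv0 : ∀ i, i ∉ insert r I → v i = 0 := fun i hi => by
    by_contra hne
    exact hi (hsupp ▸ S.mem_supp.2 hne)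
  have hvr : v r ≠ 0 := S.mem_supp.1 (hsupp ▸ Finset.mem_insert_self r I)
  intro i j
  have hu : S.specialVector p q r I J h i = v i / v r := by
    rw [S.eq_mul_specialVector hr hdet hv hv0 i, mul_div_cancel_left₀ _ hvr]
  rw [hu, fracOrd_lt_iff S.isOpen_dom]
  intro k hk
  exact FracConst.div hvr ((fracOrd_lt_iff S.isOpen_dom _ _ _).1 (hvalid i j) k hk)
    ((fracOrd_lt_iff S.isOpen_dom _ _ _).1 (hvalid r j) k hk)

end SpecialVector
end DAE

/-! ### Quotients of analytic functions on a connected open set. -/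

section Quotient

open scoped Topology

variable {E : Type*} [NormedAddCommGroup E] [NormedSpace ℝ E] {W : Set E}

/-- If the derivative of `g / δ` vanishes on a connected open set, then `g / δ` is constant. -/
theorem mul_eq_mul_of_fderiv_quotient_eq_zero (hW : IsOpen W) (hWc : IsPreconnected W)
    {g δ : E → ℝ} (hg : AnalyticOnNhd ℝ g W) (hδ : AnalyticOnNhd ℝ δ W) {w₀ : E} (hw₀ : w₀ ∈ W)
    (hne : δ w₀ ≠ 0)
    (hd : ∀ w ∈ W, ∀ v, fderiv ℝ g w v * δ w = g w * fderiv ℝ δ w v) :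
    ∀ w ∈ W, g w * δ w₀ = g w₀ * δ w := by
  -- `δ` may vanish elsewhere in `W`: constancy is proved on a ball around `w₀`, and the
  -- cross-multiplied identity is continued analytically.
  have hev : ∀ᶠ w in 𝓝 w₀, w ∈ W ∧ δ w ≠ 0 :=
    Filter.Eventually.and (hW.mem_nhds hw₀) ((hδ w₀ hw₀).continuousAt.eventually_ne hne)
  obtain ⟨ε, hε, hball⟩ := Metric.eventually_nhds_iff_ball.1 hev
  have hderiv : ∀ y ∈ Metric.ball w₀ ε, HasFDerivAt (fun w => g w * (δ w)⁻¹) (0 : E →L[ℝ] ℝ) y := by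
    intro y hy
    have hy' := hball y hy
    have h1 := (hg y hy'.1).differentiableAt.hasFDerivAt.mul
      ((hasDerivAt_inv hy'.2).comp_hasFDerivAt y (hδ y hy'.1).differentiableAt.hasFDerivAt)
    refine h1.congr_fderiv (ContinuousLinearMap.ext fun v => ?_)
    have h2 := hd y hy'.1 v
    have h3 := hy'.2
    simp only [smul_apply, add_apply, smul_eq_mul, zero_apply, Function.comp_apply]
    field_simp
    linarith
  have hconst : ∀ w ∈ Metric.ball w₀ ε, g w * (δ w)⁻¹ = g w₀ * (δ w₀)⁻¹ := by
    intro w hw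
    exact Metric.isOpen_ball.is_const_of_fderiv_eq_zero (convex_ball w₀ ε).isPreconnected
      (f := fun w => g w * (δ w)⁻¹) (𝕜 := ℝ)
      (fun y hy => (hderiv y hy).differentiableAt.differentiableWithinAt)
      (fun y hy => (hderiv y hy).fderiv) hw (Metric.mem_ball_self hε)
  have heq : (fun w => g w * δ w₀) =ᶠ[𝓝 w₀] fun w => g w₀ * δ w := by
    filter_upwards [Metric.ball_mem_nhds w₀ hε] with w hw
    have h1 := hconst w hw
    rwa [← div_eq_mul_inv, ← div_eq_mul_inv, div_eq_div_iff (hball w hw).2 hne] at h1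
  exact (hg.mul analyticOnNhd_const).eqOn_of_preconnected_of_eventuallyEq
    (analyticOnNhd_const.mul hδ) hWc hw₀ heq

theorem eq_zero_of_mul_eq_zero_of_ne_zero (hW : IsOpen W) (hWc : IsPreconnected W)
    {g δ : E → ℝ} (hg : AnalyticOnNhd ℝ g W) (hδ : AnalyticOnNhd ℝ δ W) {w₀ : E} (hw₀ : w₀ ∈ W)
    (hne : δ w₀ ≠ 0) (h : ∀ w ∈ W, δ w * g w = 0) : ∀ w ∈ W, g w = 0 := by
  have heq : g =ᶠ[𝓝 w₀] 0 := by
    filter_upwards [hW.mem_nhds hw₀, (hδ w₀ hw₀).continuousAt.eventually_ne hne] with w hw hw'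
    exact (mul_eq_zero.1 (h w hw)).resolve_left hw'
  exact hg.eqOn_zero_of_preconnected_of_eventuallyEq_zero hWc hw₀ heq

end Quotient

namespace DAE

variable {n l : ℕ} (S : DAE n l) {p q : Fin n → ℤ} {r : Fin n} {I J : Finset (Fin n)}
  {h : I.card = J.card}

/-! ### The outputs of the two methods -/

theorem fderiv_comp_glueL_inr {M : ℕ} {g : Jet n M → ℝ} {t : ℝ}
    {v : {c : Fin n × Fin (M + 1) // ¬ IsSolved p q r J c} → ℝ}
    {w : {c : Fin n × Fin (M + 1) // IsSolved p q r J c} → ℝ}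
    (hg : DifferentiableAt ℝ g (t, glue v w))
    (w' : {c : Fin n × Fin (M + 1) // IsSolved p q r J c} → ℝ) :
    fderiv ℝ (fun w => g (t, glue v w)) w w' =
      ∑ c, w' c * fderiv ℝ g (t, glue v w) (unitZ M c.1.1 (q c.1.1 - p r)) := by
  have h1 : HasFDerivAt (fun w : {c : Fin n × Fin (M + 1) // IsSolved p q r J c} → ℝ =>
      glueL (IsSolved p q r J) ((t, v), w))
      ((glueL (IsSolved p q r J)).comp (.inr ℝ _ _)) w :=
    (glueL (IsSolved p q r J)).hasFDerivAt.comp w (hasFDerivAt_prodMk_right (t, v) w)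
  have h2 : HasFDerivAt (fun w => g (t, glue v w)) _ w :=
    HasFDerivAt.comp w (g := g) hg.hasFDerivAt h1
  rw [h2.fderiv]
  change fderiv ℝ g (t, glue v w) (glueL (IsSolved p q r J) (0, w')) = _
  rw [glueL_inr, map_sum]
  refine Finset.sum_congr rfl fun c _ => ?_
  rw [map_smul, smul_eq_mul, unitX_solved c.2]

theorem analyticAt_glue {M : ℕ} {P : Fin n × Fin (M + 1) → Prop} [DecidablePred P] (t : ℝ)
    (v : {c // ¬ P c} → ℝ) (w : {c // P c} → ℝ) :
    AnalyticAt ℝ (fun w : {c // P c} → ℝ => ((t, glue v w) : Jet n M)) w :=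
  AnalyticAt.fun_comp (g := glueL P) ((glueL P).analyticAt ((t, v), w)) (analyticAt_const.prod analyticAt_id)

/-- The numerator of the equation of the LC-method, when `u = α / δ`. -/
def lcNumerator (p : Fin n → ℤ) (r : Fin n) (α : Fin n → Jet n l → ℝ) (e : ℕ)
    (y : Jet n (l + e)) : ℝ :=
  ∑ i, α i (resize l y) * S.dF i (p i - p r).toNat e y

theorem analyticOnNhd_lcNumerator {α : Fin n → Jet n l → ℝ}
    (hα : ∀ i, AnalyticOnNhd ℝ (α i) S.dom) (e : ℕ) :
    AnalyticOnNhd ℝ (S.lcNumerator p r α e) (S.domExt e) :=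
  Finset.univ.analyticOnNhd_fun_sum fun i _ =>
    (analyticOnNhd_comp_resize (hα i)).mul (S.analyticOnNhd_dF i _ e)

/-- The derivative of `N / δ` along `x_j^(q_j - p_r)` vanishes. In the product rule, the terms `α_i
∂F_i^(p_i - p_r) = α_i D_ij` cancel by `hker`, and `hvalid` turns `∑ (∂α_i) F_i^(p_i - p_r) δ` into
`N ∂δ`. -/
theorem fderiv_lcNumerator (hpq : S.DualFeasible p q) (hle : ∀ i ∈ I, p r ≤ p i)
    {α : Fin n → Jet n l → ℝ} {δ : Jet n l → ℝ} (hα : ∀ i, AnalyticOnNhd ℝ (α i) S.dom)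
    (hδ : AnalyticOnNhd ℝ δ S.dom) (hα0 : ∀ i, i ∉ insert r I → ∀ z ∈ S.dom, α i z = 0)
    (hker : ∀ j, ∀ z ∈ S.dom, ∑ i, α i z * S.jacAt p q z i j = 0) {j : Fin n}
    (hvalid : ∀ i, ∀ z ∈ S.dom, fderiv ℝ (α i) z (unitZ l j (q j - p r)) * δ z =
      α i z * fderiv ℝ δ z (unitZ l j (q j - p r)))
    {y : Jet n (l + kappa p r I)} (hy : y ∈ S.domExt (kappa p r I)) :
    fderiv ℝ (S.lcNumerator p r α (kappa p r I)) y (unitZ _ j (q j - p r)) * δ (resize l y) =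
      S.lcNumerator p r α (kappa p r I) y *
        fderiv ℝ (fun y : Jet n (l + kappa p r I) => δ (resize l y)) y (unitZ _ j (q j - p r)) := by
  have hz : resize l y ∈ S.dom := hy
  have hsum : HasFDerivAt (S.lcNumerator p r α (kappa p r I))
      (∑ i, (α i (resize l y) • fderiv ℝ (S.dF i (p i - p r).toNat (kappa p r I)) y +
        S.dF i (p i - p r).toNat (kappa p r I) y • fderiv ℝ (fun y => α i (resize l y)) y)) y :=
    HasFDerivAt.fun_sum fun i _ =>
      (analyticOnNhd_comp_resize (hα i) y hy).differentiableAt.hasFDerivAt.mul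
        (S.analyticOnNhd_dF i _ (kappa p r I) y hy).differentiableAt.hasFDerivAt
  have hres : resize l (unitZ (l + (kappa p r I)) j (q j - p r)) = unitZ l j (q j - p r) :=
    resize_unitZ (by omega) _ _
  have hterm : ∀ i, α i (resize l y) * fderiv ℝ (S.dF i (p i - p r).toNat (kappa p r I)) y
      (unitZ _ j (q j - p r)) = α i (resize l y) * S.jacAt p q (resize l y) i j := by
    intro i
    -- Outside `I ∪ {r}` the difference `p_i - p_r` may be negative or exceed `κ`; there `α_i = 0`.
    by_cases hi : i ∈ insert r I
    · have hd : (p i - p r).toNat ≤ (kappa p r I) ∧ (((p i - p r).toNat : ℕ) : ℤ) = p i - p r := by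
        rcases Finset.mem_insert.1 hi with rfl | hi
        · simp
        · exact ⟨toNat_le_kappa hi, Int.toNat_of_nonneg (sub_nonneg.2 (hle i hi))⟩
      rw [← pderiv_eq_fderiv, S.pderiv_dF hpq hd.1 hd.2 j hy]
    · rw [hα0 i hi _ hz, zero_mul, zero_mul]
  rw [hsum.fderiv, fderiv_comp_resize (hδ _ hz).differentiableAt, hres]
  simp only [sum_apply, add_apply, smul_apply, smul_eq_mul, Finset.sum_add_distrib, hterm,
    hker j _ hz, zero_add, lcNumerator, Finset.sum_mul]
  refine Finset.sum_congr rfl fun i _ => ?_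
  rw [fderiv_comp_resize (hα i _ hz).differentiableAt, hres]
  linear_combination (S.dF i (p i - p r).toNat (kappa p r I) y) * hvalid i _ hz

theorem lift_algebraMap (e : ℕ) (a : analyticRing S.dom) :
    S.lift e (algebraMap _ S.K a) = algebraMap _ (S.KExt e) (S.liftRing e a) :=
  IsLocalization.map_eq (T := nonZeroDivisors (analyticRing (S.domExt e)))
    (nonZeroDivisors_le_comap_nonZeroDivisors_of_injective _ (S.liftRing_injective e)) a

/-- `F_i^(d)` as an element of the ring of analytic functions. -/
def dFRing (i : Fin n) (d e : ℕ) : analyticRing (S.domExt e) :=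
  restrict (S.dF i d e) (S.analyticOnNhd_dF i d e)

/-- Row `r` fits the general term because `p_r - p_r = 0`, and indices outside the support
contribute zero. -/
theorem lcOutput_self (u : Fin n → S.K) (hr : r ∈ S.supp u) (e : ℕ) :
    S.lcOutput p r u e r = ∑ i, S.lift e (u i) * algebraMap _ (S.KExt e)
      (S.dFRing i (p i - p r).toNat e) := by
  rw [← Finset.sum_subset (Finset.subset_univ (S.supp u)), ← Finset.add_sum_erase _ _ hr, lcOutput,
    if_pos rfl]
  · congr 3
    rw [sub_self]
    rfl
  · intro i _ hi
    rw [S.mem_supp, not_not] at hi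
    rw [hi, map_zero, zero_mul]

theorem lcOutput_mul_eq (u : Fin n → S.K) (hr : r ∈ S.supp u) (e : ℕ) {Δ : analyticRing S.dom}
    {a : Fin n → analyticRing S.dom}
    (ha : ∀ i, u i * algebraMap _ S.K Δ = algebraMap _ S.K (a i)) :
    S.lcOutput p r u e r * algebraMap _ (S.KExt e) (S.liftRing e Δ) =
      algebraMap _ (S.KExt e) (∑ i, S.liftRing e (a i) * S.dFRing i (p i - p r).toNat e) := by
  rw [S.lcOutput_self u hr, Finset.sum_mul, map_sum]
  refine Finset.sum_congr rfl fun i _ => ?_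
  rw [map_mul, ← lift_algebraMap, ← lift_algebraMap, ← ha, map_mul, mul_right_comm]

theorem fracEqOn_algebraMap {E : Type*} [NormedAddCommGroup E] [NormedSpace ℝ E] {U : Set E}
    [IsDomain (analyticRing U)] {g : E → ℝ} (hg : AnalyticOnNhd ℝ g U) (V : Set E) :
    FracEqOn (algebraMap _ (FractionRing (analyticRing U)) (restrict g hg)) g V := by
  intro a b _ hab z _
  rw [← map_mul] at hab
  have := IsFractionRing.injective (analyticRing U) (FractionRing (analyticRing U)) hab
  rw [← this]
  rfl

/-- With `t` and the unsolved coordinates fixed, the comparison takes place on the slice over `W`: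
there `N / δ` equals its value at `φ(t, v)`, which is the substituted `F_r`. -/
theorem fracEqOn_output (hpq : S.DualFeasible p q) (hr : r ∉ I) (hle : ∀ i ∈ I, p r ≤ p i)
    (hdet : (sub (S.jac p q) I J h).det ≠ 0)
    (hker : S.IsCokernel p q (S.specialVector p q r I J h))
    (hvalid : S.LCValid p q r (S.specialVector p q r I J h))
    (Φ : S.ExplicitFunction p q r I J h) :
    FracEqOn (S.lcOutput p r (S.specialVector p q r I J h) (kappa p r I) r) (Φ.output r)
      Φ.domain := by
  set κ := kappa p r I with hκ
  set u := S.specialVector p q r I J h with hu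
  set Δ := (sub (S.jacRing p q) I J h).det with hΔ
  have hinj := IsFractionRing.injective (analyticRing S.dom) S.K
  have hΔ0 : Δ ≠ 0 := by
    intro h0
    apply hdet
    rw [det_sub_jac, ← hΔ, h0, map_zero]
  obtain ⟨a, ha⟩ := S.exists_numerator hr hdet
  choose α hα haα using fun i => (a i).2
  obtain ⟨δ, hδ, hΔδ⟩ := Δ.2
  have hα0 : ∀ i, i ∉ insert r I → ∀ z ∈ S.dom, α i z = 0 := by
    intro i hi z hz
    have h1 : a i = 0 := hinj (by rw [← ha, S.specialVector_eq_zero hi, zero_mul, map_zero])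
    have h2 := haα i ⟨z, hz⟩
    rw [← h2, h1]
    rfl
  have hαr : ∀ z ∈ S.dom, α r z = δ z := by
    intro z hz
    have h1 : a r = Δ := hinj (by rw [← ha, specialVector_self, one_mul])
    have h2 := haα r ⟨z, hz⟩
    have h3 := hΔδ ⟨z, hz⟩
    simp only at h2 h3
    rw [← h2, ← h3, ← h1]
  have hker' : ∀ j, ∀ z ∈ S.dom, ∑ i, α i z * S.jacAt p q z i j = 0 := by
    intro j z hz
    have h1 : ∑ i, a i * S.jacRing p q i j = 0 := by
      apply hinj
      rw [map_sum, map_zero]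
      have h2 := congrFun hker j
      have h3 : ∑ i, u i * S.jac p q i j = 0 := h2
      rw [← zero_mul (algebraMap _ S.K Δ), ← h3, Finset.sum_mul]
      refine Finset.sum_congr rfl fun i _ => ?_
      rw [map_mul, ← ha, mul_right_comm]
      rfl
    have h2 := congrArg (evalHom ⟨z, hz⟩) h1
    rw [map_sum, map_zero] at h2
    rw [← h2]
    refine Finset.sum_congr rfl fun i _ => ?_
    rw [map_mul]
    congr 1
    exact (haα i ⟨z, hz⟩).symm
  have hval : ∀ j i, ∀ z ∈ S.dom, fderiv ℝ (α i) z (unitZ l j (q j - p r)) * δ z =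
      α i z * fderiv ℝ δ z (unitZ l j (q j - p r)) := by
    intro j i z hz
    have h1 := (fracOrd_lt_iff S.isOpen_dom _ _ _).1 (hvalid i j) _ le_rfl (a i) Δ hΔ0 (ha i)
    have h2 : ringDeriv _ (a i) ⟨z, hz⟩ * Δ.1 ⟨z, hz⟩ = (a i).1 ⟨z, hz⟩ * ringDeriv _ Δ ⟨z, hz⟩ :=
      congrFun (congrArg Subtype.val h1) ⟨z, hz⟩
    rw [ringDeriv_eq_fderiv S.isOpen_dom (haα i), ringDeriv_eq_fderiv S.isOpen_dom hΔδ] at h2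
    have h3 := haα i ⟨z, hz⟩
    have h4 := hΔδ ⟨z, hz⟩
    simp only at h3 h4
    rw [← h3, ← h4]
    exact h2
  intro A B _ hAB z hz
  obtain ⟨ht, hv, hw⟩ := hz
  set t := (z : Jet n (l + κ)).1
  set v : {c : Fin n × Fin (l + κ + 1) // ¬ IsSolved p q r J c} → ℝ :=
    fun c => (z : Jet n (l + κ)).2 c.1
  set w₀ := Φ.φ (t, v)
  have hdom : ∀ w ∈ Φ.W, ((t, glue v w) : Jet n (l + κ)) ∈ S.domExt κ :=
    Φ.subset_dom t ht v hv
  have hw₀ : w₀ ∈ Φ.W := Φ.mapsTo t ht v hv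
  have hδ0 : δ (resize l ((t, glue v w₀) : Jet n (l + κ))) ≠ 0 := by
    have h1 := Φ.nonsingular t ht v hv
    rw [S.sub_pderiv_dF hpq hle h (hdom w₀ hw₀)] at h1
    have h2 := S.det_sub_jacAt (p := p) (q := q) h ⟨_, hdom w₀ hw₀⟩
    rw [← hΔδ ⟨_, hdom w₀ hw₀⟩]
    exact fun h0 => h1 (h2.trans h0)
  set δ' : Jet n (l + κ) → ℝ := fun y => δ (resize l y) with hδ'
  have hδa : AnalyticOnNhd ℝ δ' (S.domExt κ) := analyticOnNhd_comp_resize hδ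
  have hslice : ∀ {g : Jet n (l + κ) → ℝ}, AnalyticOnNhd ℝ g (S.domExt κ) →
      AnalyticOnNhd ℝ (fun w => g (t, glue v w)) Φ.W := fun hg w hw =>
    AnalyticAt.fun_comp (hg _ (hdom w hw)) (analyticAt_glue t v w)
  have hNa := S.analyticOnNhd_lcNumerator (p := p) (r := r) hα κ
  have hconst := mul_eq_mul_of_fderiv_quotient_eq_zero Φ.isOpen_W Φ.isConnected_W.isPreconnected
    (hslice hNa) (hslice hδa) hw₀ hδ0 (by
      intro w hw w'
      have hy := hdom w hw
      rw [fderiv_comp_glueL_inr (hNa _ hy).differentiableAt,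
        fderiv_comp_glueL_inr (hδa _ hy).differentiableAt, Finset.sum_mul, Finset.mul_sum]
      refine Finset.sum_congr rfl fun c _ => ?_
      have := S.fderiv_lcNumerator hpq hle hα hδ hα0 hker' (hval c.1.1) hy
      linear_combination (w' c) * this)
  -- At `w₀` the equations indexed by `I` vanish, so only the term of `r` survives, with `α_r = δ`
  -- because `u_r = 1`.
  have hN₀ : S.lcNumerator p r α κ (t, glue v w₀) = δ' (t, glue v w₀) * Φ.output r z := by
    have hzero := (Φ.eq_zero_iff t ht v hv w₀ hw₀).2 rfl
    have hmem : resize l ((t, glue v w₀) : Jet n (l + κ)) ∈ S.dom := hdom w₀ hw₀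
    rw [lcNumerator, Finset.sum_eq_single r]
    · rw [hαr _ hmem, sub_self]
      simp only [ExplicitFunction.output, if_pos]
      rfl
    · intro i _ hir
      by_cases hi : i ∈ I
      · rw [hzero i hi, mul_zero]
      · rw [hα0 i (by simp [hir, hi]) _ hmem, zero_mul]
    · simp
  have hN : ∀ w ∈ Φ.W, S.lcNumerator p r α κ (t, glue v w) =
      Φ.output r z * δ' (t, glue v w) := by
    intro w hw
    have h1 := hconst w hw
    rw [hN₀] at h1
    exact mul_right_cancel₀ hδ0 (h1.trans (by ring))
  have hrs : r ∈ S.supp u := (S.isPivot_specialVector hle).1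
  -- `A / B` is an arbitrary representation of the LC-output; cross-multiplication compares it with
  -- `N / δ`.
  have hring : (∑ i, S.liftRing κ (a i) * S.dFRing i (p i - p r).toNat κ) * B =
      A * S.liftRing κ Δ := by
    apply IsFractionRing.injective (analyticRing (S.domExt κ)) (S.KExt κ)
    rw [map_mul, map_mul, ← S.lcOutput_mul_eq u hrs κ ha, ← hAB, mul_right_comm]
  obtain ⟨f, hf, hAf⟩ := A.2
  obtain ⟨g, hg, hBg⟩ := B.2
  have hpt : ∀ y ∈ S.domExt κ, S.lcNumerator p r α κ y * g y = f y * δ' y := by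
    intro y hy
    have h1 := congrArg (evalHom ⟨y, hy⟩) hring
    rw [map_mul, map_mul, map_sum] at h1
    simp only [map_mul, evalHom_apply] at h1
    have h2 : (S.liftRing κ Δ).1 ⟨y, hy⟩ = δ' y := hΔδ ⟨_, hy⟩
    have h3 : ∀ i, (S.liftRing κ (a i)).1 ⟨y, hy⟩ = α i (resize l y) := fun i => haα i ⟨_, hy⟩
    have h4 : A.1 ⟨y, hy⟩ = f y := hAf ⟨y, hy⟩
    have h5 : B.1 ⟨y, hy⟩ = g y := hBg ⟨y, hy⟩
    simp only [h2, h3, h4, h5] at h1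
    exact h1
  -- `δ'` may vanish at `z` itself, so it is cancelled on the whole slice, using that it is nonzero
  -- at `w₀`.
  have hfin := eq_zero_of_mul_eq_zero_of_ne_zero Φ.isOpen_W Φ.isConnected_W.isPreconnected
    ((hslice hf).sub (analyticOnNhd_const (v := Φ.output r z) |>.mul (hslice hg))) (hslice hδa)
    hw₀ hδ0 (by
      intro w hw
      have h1 := hpt _ (hdom w hw)
      rw [hN w hw] at h1
      simp only [Pi.sub_apply]
      linear_combination -h1) _ hw
  have hzz : ((t, glue v fun c => (z : Jet n (l + κ)).2 c.1) : Jet n (l + κ)) = z :=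
    Prod.ext rfl (glue_restrict _)
  have h4 : A.1 z = f z := hAf z
  have h5 : B.1 z = g z := hBg z
  rw [h4, h5, ← congrArg f hzz, ← congrArg g hzz]
  exact sub_eq_zero.1 hfin

end DAE

end StructuralDAE

end

/-! ### The main theorem. -/

theorem mainTheorem4 {n l : ℕ} (S : StructuralDAE.DAE n l) (p q : Fin n → ℤ)
    (hpq : S.DualOptimal p q) (hI : S.InputConditions p q)
    (r : Fin n) (I J : Finset (Fin n)) (hT : S.IsTriple p q r I J) :
    S.IsCokernel p q (S.specialVector p q r I J hT.card_eq) ∧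
    S.IsPivot p (S.specialVector p q r I J hT.card_eq) r ∧
    Nonempty (S.ExplicitFunction p q r I J hT.card_eq) ∧
    (S.LCValid p q r (S.specialVector p q r I J hT.card_eq) →
      ∀ (Φ : S.ExplicitFunction p q r I J hT.card_eq) (i : Fin n),
        StructuralDAE.FracEqOn
          (S.lcOutput p r (S.specialVector p q r I J hT.card_eq)
            (StructuralDAE.DAE.kappa p r I) i)
          (Φ.output i) Φ.domain) ∧
    (¬ S.LCValid p q r (S.specialVector p q r I J hT.card_eq) →
      ∀ v : Fin n → S.K, S.IsCokernel p q v → S.supp v = insert r I →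
        S.IsPivot p v r ∧ ¬ S.LCValid p q r v) := by
  have hker := S.isCokernel_specialVector hT.notMem hT.nonsingular hT.rank_eq
  refine ⟨hker, S.isPivot_specialVector hT.le, ?_, ?_, ?_⟩
  -- By (C1) the submatrix `D[I, J]` is not identically singular, so (I2) supplies a consistent
  -- point at which it is nonsingular.
  · obtain ⟨z, -, hz, hdet⟩ := hI.exists_consistent I J hT.card_eq
      (S.exists_det_sub_jacAt_ne_zero hT.nonsingular)
    exact S.nonempty_explicitFunction hpq.1 hT.le hT.card_eq hz hdet
  · intro hvalid Φ i
    by_cases hi : i = r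
    · subst hi
      exact S.fracEqOn_output hpq.1 hT.notMem hT.le hT.nonsingular hker hvalid Φ
    · have h1 : Φ.output i = S.dF i 0 (StructuralDAE.DAE.kappa p r I) :=
        funext fun z => if_neg hi
      rw [StructuralDAE.DAE.lcOutput, if_neg hi, h1]
      exact StructuralDAE.DAE.fracEqOn_algebraMap _ _
  · intro hnot v hv hsupp
    refine ⟨⟨hsupp ▸ Finset.mem_insert_self r I, fun i hi => ?_⟩, fun hvalid =>
      hnot (S.lcValid_specialVector hT.notMem hT.nonsingular hv hsupp hvalid)⟩
    rcases Finset.mem_insert.1 (hsupp ▸ hi) with rfl | hi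
    · exact le_rfl
    · exact hT.le i hi
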